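/- **Setting.** Let $\Theta\subset\mathbb R^p$, and let $\psi_1,\psi_0$ be estimating functions: for each $z\in\{0,1\}$, outcome value $y\in\mathcal Y$ and covariate value $x\in\mathcal X$, $\theta\mapsto\psi_z(y,x;\theta)$ is a function $\Theta\to\mathbb R^p$. Consider a sequence of finite populations, indexed by their size $N\ge N_0$; the $N$-th consists of $N$ units with fixed potential outcomes $Y_i(1),Y_i(0)\in\mathcal Y$ and fixed covariates $X_i\in\mathcal X$ (which may all depend on $N$). In a completely randomized experiment $n_1$ of the $N$ units are assigned to treatment ($Z_i=1$) and $n_0=N-n_1$ to control ($Z_i=0$), every assignment with $n_1$ treated units having probability $1/\binom{N}{n_1}$. Let $r_z=n_z/N$, $Y_i=Z_iY_i(1)+(1-Z_i)Y_i(0)$ and $\psi_{zi}(\theta)=\psi_z(Y_i(z),X_i;\theta)$. Write $E_N(c_i)=N^{-1}\sum_i c_i$ and $\mathrm{Cov}_N(c_i)=(N-1)^{-1}\sum_j\{c_j-E_N(c_i)\}\{c_j-E_N(c_i)\}^\top$. Put $$\hat\Psi_N(\theta)=E_N\{\psi_{Z_i}(Y_i,X_i;\theta)\},\qquad \Psi_N(\theta)=E\{\hat\Psi_N(\theta)\}=r_1E_N\{\psi_{1i}(\theta)\}+r_0E_N\{\psi_{0i}(\theta)\}.$$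 A dot denotes the derivative in $\theta\in\Theta$; $\sigma_{\max}$, $\sigma_{\min}$ are the largest and smallest singular values; and $\Delta(f,\theta_N,\delta)=\sup_{\theta\in\Theta:\|\theta-\theta_N\|\le\delta}\|f(\theta)-f(\theta_N)\|$. Suprema over $N$ and "for all $N$" refer to $N\ge N_0$. Let $\theta_N$ be a sequence of points and $\hat\theta_N$ a sequence of random vectors, the $N$-th defined on the probability space of the $N$-th experiment. Assume: 1. (Interior root) $\theta_N\in\Theta$ and $\Psi_N(\theta_N)=0$ for all $N$, and there is $\varepsilon_0>0$ with $\{\theta:\|\theta-\theta_N\|<\varepsilon_0\}\subset\Theta$ for all $N$. 2. (Smoothness) For $z=0,1$ and all $(x,y)\in\mathcal X\times\mathcal Y$, $\psi_z(y,x;\theta)$ is continuously differentiable in $\theta\in\Theta$; and, as $\delta\to0$, $\sup_N E_N\{\Delta(\dot\psi_{zi},\theta_N,\delta)\}\to0$ and $\sup_N E_N\{\Delta^2(\psi_{zi},\theta_N,\delta)\}\to0$. 3. (Boundedness) $r_1$ and $r_0$ are bounded away from $0$ and $1$; and, for $z=0,1$: (i) there is $c_0>0$ with $\sigma_{\max}(\mathrm{Cov}_N\{\psi_{zi}(\theta_N)\})\le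 c_0$ for all $N$; (ii) there are $c_2>c_1>0$ with $c_1\le\sigma_{\min}(\dot\Psi_N(\theta_N))\le\sigma_{\max}(\dot\Psi_N(\theta_N))\le c_2$ for all $N$; (iii) $N^{-1}\max_{1\le j\le N}\|\psi_{zj}(\theta_N)-E_N\{\psi_{zi}(\theta_N)\}\|^2\to0$ as $N\to\infty$. 4. (Consistency) $\hat\theta_N\in\Theta$ and $\hat\Psi_N(\hat\theta_N)=0$ almost surely; $\hat\theta_N-\theta_N\to0$ in probability; and there is $\rho>0$ such that $\sup_{\theta\in\Theta:\|\theta-\theta_N\|\le\rho}\|\dot{\hat\Psi}_N(\theta)-\dot\Psi_N(\theta)\|\to0$ in probability as $N\to\infty$. **Theorem.** Under assumptions 1–4, the Lévy–Prokhorov distance between the law of $\sqrt N(\hat\theta_N-\theta_N)$ and the Gaussian law $\mathcal N(0,\Sigma_N)$ converges to $0$ as $N\to\infty$, where $$\Sigma_N=r_1r_0\,\{\dot\Psi_N(\theta_N)\}^{-1}\,\mathrm{Cov}_N\{\psi_{1i}(\theta_N)-\psi_{0i}(\theta_N)\}\,\{\dot\Psi_N(\theta_N)^\top\}^{-1}.$$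 -/

import Mathlib

open MeasureTheory ProbabilityTheory Filter Topology
open scoped ENNReal

namespace RandomizedZ

/-- The space `ℝᵖ` with its Euclidean norm. -/
abbrev Vec (p : ℕ) : Type := EuclideanSpace ℝ (Fin p)

/-- A finite population of `N` units with fixed covariates `X i` and fixed potential outcomes
`Y z i` (`z = true` is treatment, `z = false` is control), of which `treated` units are to be
assigned to treatment. -/
structure Population (𝒳 𝒴 : Type*) (N : ℕ) where
  X : Fin N → 𝒳
  Y : Bool → Fin N → 𝒴
  treated : ℕ
  treated_le : treated ≤ N

/-- The finite population average `E_N(c_i)`. -/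
noncomputable def avg {N : ℕ} {V : Type*} [AddCommGroup V] [Module ℝ V] (c : Fin N → V) : V :=
  (N : ℝ)⁻¹ • ∑ i, c i

/-- The finite population covariance matrix `Cov_N(c_i)`, with divisor `N - 1`. -/
noncomputable def cov {N p : ℕ} (c : Fin N → Vec p) : Matrix (Fin p) (Fin p) ℝ :=
  Matrix.of fun a b => ((N : ℝ) - 1)⁻¹ * ∑ j, (c j - avg c) a * (c j - avg c) b

/-- The number of treated units of an assignment. -/
def numTreated {N : ℕ} (z : Fin N → Bool) : ℕ := (Finset.univ.filter fun i => z i = true).card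

/-- `Z` is the assignment of a completely randomized experiment with `n₁` treated units among `N`:
every assignment with exactly `n₁` treated units has probability `1 / (N choose n₁)`. -/
def IsCRE {Ω : Type*} [MeasurableSpace Ω] (P : Measure Ω) {N : ℕ} (n₁ : ℕ)
    (Z : Ω → Fin N → Bool) : Prop :=
  Measurable Z ∧
    ∀ z : Fin N → Bool, P (Z ⁻¹' {z}) = if numTreated z = n₁ then ((N.choose n₁ : ℕ) : ℝ≥0∞)⁻¹ else 0

section Estimating

variable {𝒳 𝒴 : Type*} {N p : ℕ}

/-- The proportions `r₁ = n₁ / N` and `r₀ = (N - n₁) / N`. -/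
noncomputable def Population.r (e : Population 𝒳 𝒴 N) (z : Bool) : ℝ :=
  if z = true then (e.treated : ℝ) / N else ((N : ℝ) - e.treated) / N

/-- `ψ_{zi}(θ) = ψ_z(Y_i(z), X_i; θ)`. -/
def unitPsi (ψ : Bool → 𝒴 → 𝒳 → Vec p → Vec p) (e : Population 𝒳 𝒴 N) (z : Bool) (i : Fin N)
    (θ : Vec p) : Vec p :=
  ψ z (e.Y z i) (e.X i) θ

/-- The empirical estimating function `Ψ̂_N(θ) = E_N{ψ_{Z_i}(Y_i, X_i; θ)}`, where `Y_i = Y_i(Z_i)`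
is the observed outcome. -/
noncomputable def empPsi (ψ : Bool → 𝒴 → 𝒳 → Vec p → Vec p) (e : Population 𝒳 𝒴 N)
    (Z : Fin N → Bool) (θ : Vec p) : Vec p :=
  avg fun i => ψ (Z i) (e.Y (Z i) i) (e.X i) θ

/-- The population estimating function
`Ψ_N(θ) = r₁ E_N{ψ₁(Y_i(1), X_i; θ)} + r₀ E_N{ψ₀(Y_i(0), X_i; θ)}`. -/
noncomputable def popPsi (ψ : Bool → 𝒴 → 𝒳 → Vec p → Vec p) (e : Population 𝒳 𝒴 N)
    (θ : Vec p) : Vec p :=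
  e.r true • avg (fun i => unitPsi ψ e true i θ) + e.r false • avg (fun i => unitPsi ψ e false i θ)

/-- `Δ(f, θ₀, δ)`, the supremum of `‖f(θ) - f(θ₀)‖` over `θ ∈ Θ` with `‖θ - θ₀‖ ≤ δ`
(possibly infinite). -/
noncomputable def osc {F : Type*} [NormedAddCommGroup F] (Θ : Set (Vec p)) (f : Vec p → F)
    (θ₀ : Vec p) (δ : ℝ) : ℝ≥0∞ :=
  ⨆ θ ∈ {θ | θ ∈ Θ ∧ ‖θ - θ₀‖ ≤ δ}, ‖f θ - f θ₀‖ₑ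

/-- The Jacobian matrix at `θ` of a function on the parameter space `Θ`. -/
noncomputable def jacobian (Θ : Set (Vec p)) (f : Vec p → Vec p) (θ : Vec p) :
    Matrix (Fin p) (Fin p) ℝ :=
  Matrix.of fun a b => (fderivWithin ℝ f Θ θ (EuclideanSpace.single b 1)) a

/-- The largest singular value. -/
noncomputable def sigmaMax (A : Matrix (Fin p) (Fin p) ℝ) : ℝ :=
  (Matrix.toEuclideanLin A).singularValues 0

/-- The smallest singular value. -/
noncomputable def sigmaMin (A : Matrix (Fin p) (Fin p) ℝ) : ℝ :=
  (Matrix.toEuclideanLin A).singularValues (p - 1)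

/-- The sandwich matrix
`r₁ r₀ Ψ̇_N(θ)⁻¹ Cov_N{ψ_{1i}(θ) - ψ_{0i}(θ)} (Ψ̇_N(θ)ᵀ)⁻¹`. -/
noncomputable def sandwich (Θ : Set (Vec p)) (ψ : Bool → 𝒴 → 𝒳 → Vec p → Vec p)
    (e : Population 𝒳 𝒴 N) (θ : Vec p) : Matrix (Fin p) (Fin p) ℝ :=
  (e.r true * e.r false) •
    ((jacobian Θ (popPsi ψ e) θ)⁻¹ *
      cov (fun i => unitPsi ψ e true i θ - unitPsi ψ e false i θ) *
      ((jacobian Θ (popPsi ψ e) θ).transpose)⁻¹)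

end Estimating

section Conditions

variable {𝒳 𝒴 : Type*} {p : ℕ}

/-- `‖ξ_N‖ = o_pr(1)` for nonnegative random quantities `ξ_N` on possibly different spaces. -/
def IsLittleOPr {Ω : ℕ → Type*} [∀ N, MeasurableSpace (Ω N)] (P : ∀ N, Measure (Ω N))
    (ξ : ∀ N, Ω N → ℝ≥0∞) : Prop :=
  ∀ ε : ℝ≥0∞, 0 < ε → Tendsto (fun N => P N {ω | ε ≤ ξ N ω}) atTop (𝓝 0)

/-- Interior root. -/
def InteriorRoot (N₀ : ℕ) (Θ : Set (Vec p)) (ψ : Bool → 𝒴 → 𝒳 → Vec p → Vec p)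
    (e : ∀ N, Population 𝒳 𝒴 N) (θ : ℕ → Vec p) : Prop :=
  (∀ N, N₀ ≤ N → θ N ∈ Θ ∧ popPsi ψ (e N) (θ N) = 0) ∧
  ∃ ε > 0, ∀ N, N₀ ≤ N → Metric.ball (θ N) ε ⊆ Θ

/-- Smoothness. -/
def Smoothness (N₀ : ℕ) (Θ : Set (Vec p)) (ψ : Bool → 𝒴 → 𝒳 → Vec p → Vec p)
    (e : ∀ N, Population 𝒳 𝒴 N) (θ : ℕ → Vec p) : Prop :=
  ∀ z : Bool,
    (∀ y x, ContDiffOn ℝ 1 (ψ z y x) Θ) ∧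
    Tendsto (fun δ : ℝ => ⨆ N ≥ N₀,
      (∑ i, osc Θ (fderivWithin ℝ (unitPsi ψ (e N) z i) Θ) (θ N) δ) / (N : ℝ≥0∞))
      (𝓝[>] 0) (𝓝 0) ∧
    Tendsto (fun δ : ℝ => ⨆ N ≥ N₀,
      (∑ i, osc Θ (unitPsi ψ (e N) z i) (θ N) δ ^ 2) / (N : ℝ≥0∞))
      (𝓝[>] 0) (𝓝 0)

/-- Boundedness. -/
def Boundedness (N₀ : ℕ) (Θ : Set (Vec p)) (ψ : Bool → 𝒴 → 𝒳 → Vec p → Vec p)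
    (e : ∀ N, Population 𝒳 𝒴 N) (θ : ℕ → Vec p) : Prop :=
  (∃ c > 0, ∀ N, N₀ ≤ N → ∀ z, c ≤ (e N).r z ∧ (e N).r z ≤ 1 - c) ∧
  (∀ z, ∃ c₀ > 0, ∀ N, N₀ ≤ N → sigmaMax (cov fun i => unitPsi ψ (e N) z i (θ N)) ≤ c₀) ∧
  (∃ c₁ c₂ : ℝ, 0 < c₁ ∧ c₁ < c₂ ∧ ∀ N, N₀ ≤ N →
    c₁ ≤ sigmaMin (jacobian Θ (popPsi ψ (e N)) (θ N)) ∧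
    sigmaMax (jacobian Θ (popPsi ψ (e N)) (θ N)) ≤ c₂) ∧
  ∀ z, Tendsto (fun N : ℕ => (N : ℝ)⁻¹ * ⨆ j : Fin N,
      ‖unitPsi ψ (e N) z j (θ N) - avg (fun i => unitPsi ψ (e N) z i (θ N))‖ ^ 2)
    atTop (𝓝 0)

/-- Consistency: `θ̂_N` is (almost surely) a root in `Θ` of the empirical estimating function, it is
consistent for `θ_N`, and the derivative of the empirical estimating function converges uniformly
near `θ_N`. -/
def Consistency {Ω : ℕ → Type*} [∀ N, MeasurableSpace (Ω N)] (P : ∀ N, Measure (Ω N))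
    (Z : ∀ N, Ω N → Fin N → Bool) (N₀ : ℕ) (Θ : Set (Vec p))
    (ψ : Bool → 𝒴 → 𝒳 → Vec p → Vec p) (e : ∀ N, Population 𝒳 𝒴 N) (θ : ℕ → Vec p)
    (θhat : ∀ N, Ω N → Vec p) : Prop :=
  (∀ N, N₀ ≤ N → ∀ᵐ ω ∂(P N), θhat N ω ∈ Θ ∧ empPsi ψ (e N) (Z N ω) (θhat N ω) = 0) ∧
  IsLittleOPr P (fun N ω => ‖θhat N ω - θ N‖ₑ) ∧
  ∃ ρ > 0, IsLittleOPr P (fun N ω => ⨆ ϑ ∈ {ϑ | ϑ ∈ Θ ∧ ‖ϑ - θ N‖ ≤ ρ},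
    ‖fderivWithin ℝ (empPsi ψ (e N) (Z N ω)) Θ ϑ - fderivWithin ℝ (popPsi ψ (e N)) Θ ϑ‖ₑ)

end Conditions


/-! The population estimating function is the expectation of the empirical one. -/

theorem numTreated_comp {N : ℕ} (σ : Equiv.Perm (Fin N)) (z : Fin N → Bool) :
    numTreated (z ∘ σ) = numTreated z := by
  unfold numTreated
  refine Finset.card_bij (fun i _ => σ i) ?_ (fun _ _ _ _ h => σ.injective h) ?_
  · intro i hi; simpa using hi
  · intro j hj; exact ⟨σ.symm j, by simpa using hj, by simp⟩

theorem IsCRE.real_eq {Ω : Type*} [MeasurableSpace Ω] {P : Measure Ω} {N n₁ : ℕ}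
    {Z : Ω → Fin N → Bool} (h : IsCRE P n₁ Z) (z : Fin N → Bool) :
    P.real (Z ⁻¹' {z}) = if numTreated z = n₁ then ((N.choose n₁ : ℕ) : ℝ)⁻¹ else 0 := by
  rw [Measure.real, h.2]; split_ifs <;> simp

theorem IsCRE.integral_eq {Ω : Type*} [MeasurableSpace Ω] {P : Measure Ω} [IsProbabilityMeasure P]
    {N n₁ : ℕ} {Z : Ω → Fin N → Bool} (h : IsCRE P n₁ Z) {V : Type*} [NormedAddCommGroup V]
    [NormedSpace ℝ V] [CompleteSpace V] (f : (Fin N → Bool) → V) :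
    ∫ ω, f (Z ω) ∂P = ∑ z, P.real (Z ⁻¹' {z}) • f z := by
  have hm := h.1
  have : IsProbabilityMeasure (P.map Z) := Measure.isProbabilityMeasure_map hm.aemeasurable
  rw [← integral_map (f := f) hm.aemeasurable 
      AEStronglyMeasurable.of_discrete,
    integral_fintype (Integrable.of_finite)]
  refine Finset.sum_congr rfl fun z _ => ?_
  rw [map_measureReal_apply hm (MeasurableSet.singleton z)]

theorem IsCRE.sum_treated {Ω : Type*} [MeasurableSpace Ω] {P : Measure Ω} [IsProbabilityMeasure P]
    {N n₁ : ℕ} {Z : Ω → Fin N → Bool} (h : IsCRE P n₁ Z) (i : Fin N) :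
    ∑ z, P.real (Z ⁻¹' {z}) * (if z i = true then (1 : ℝ) else 0) = (n₁ : ℝ) / N := by
  set g : Fin N → ℝ := fun i => ∑ z, P.real (Z ⁻¹' {z}) * (if z i = true then (1 : ℝ) else 0)
    with hg
  have hsym : ∀ j, g j = g i := by
    intro j
    refine Fintype.sum_equiv ((Equiv.swap i j).arrowCongr (Equiv.refl Bool)) _ _ fun z => ?_
    have e1 : ((Equiv.swap i j).arrowCongr (Equiv.refl Bool)) z = z ∘ Equiv.swap i j := by
      ext k; simp
    rw [e1, h.real_eq, h.real_eq, numTreated_comp]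
    simp
  have hone : ∑ z, P.real (Z ⁻¹' {z}) = 1 := by
    have := h.integral_eq (fun _ => (1 : ℝ))
    simpa using this.symm
  have htot : ∑ j, g j = n₁ := by
    simp only [hg]
    rw [Finset.sum_comm]
    have : ∀ z : Fin N → Bool,
        ∑ j, P.real (Z ⁻¹' {z}) * (if z j = true then (1 : ℝ) else 0)
          = P.real (Z ⁻¹' {z}) * n₁ := by
      intro z
      rw [← Finset.mul_sum, Finset.sum_boole, h.real_eq]
      split_ifs with hz
      · rw [← hz]; rfl
      · simp
    rw [Finset.sum_congr rfl fun z _ => this z, ← Finset.sum_mul, hone, one_mul]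
  have hN : (N : ℝ) ≠ 0 := by
    have := i.pos
    positivity
  rw [Finset.sum_congr rfl fun j _ => hsym j] at htot
  simp only [Finset.sum_const, Finset.card_univ, Fintype.card_fin, nsmul_eq_mul] at htot
  change g i = _
  field_simp
  linarith

theorem popPsi_eq_integral {𝒳 𝒴 Ω : Type*} {N p : ℕ} [MeasurableSpace Ω] {P : Measure Ω}
    [IsProbabilityMeasure P] (ψ : Bool → 𝒴 → 𝒳 → Vec p → Vec p) (e : Population 𝒳 𝒴 N)
    {Z : Ω → Fin N → Bool} (h : IsCRE P e.treated Z) (θ : Vec p) :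
    popPsi ψ e θ = ∫ ω, empPsi ψ e (Z ω) θ ∂P := by
  rw [h.integral_eq (fun z => empPsi ψ e z θ)]
  have hone : ∑ z, P.real (Z ⁻¹' {z}) = 1 := by
    have := h.integral_eq (fun _ => (1 : ℝ))
    simpa using this.symm
  simp only [empPsi, avg, popPsi, unitPsi]
  have key : ∀ i : Fin N, ∑ z, P.real (Z ⁻¹' {z}) • ψ (z i) (e.Y (z i) i) (e.X i) θ
      = e.r true • ψ true (e.Y true i) (e.X i) θ + e.r false • ψ false (e.Y false i) (e.X i) θ := by
    intro i
    have hN : (N : ℝ) ≠ 0 := by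
      have := i.pos
      positivity
    have hr1 : e.r true = ∑ z, P.real (Z ⁻¹' {z}) * (if z i = true then (1 : ℝ) else 0) := by
      rw [h.sum_treated i]; simp [Population.r]
    have hr0 : e.r false = ∑ z, P.real (Z ⁻¹' {z}) * (if z i = true then (0 : ℝ) else 1) := by
      have h1 : e.r false = 1 - e.r true := by simp [Population.r]; field_simp
      rw [h1, hr1]
      nth_rewrite 1 [← hone]
      rw [← Finset.sum_sub_distrib]
      refine Finset.sum_congr rfl fun z _ => ?_
      split_ifs <;> ring
    rw [hr1, hr0, Finset.sum_smul, Finset.sum_smul, ← Finset.sum_add_distrib]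
    refine Finset.sum_congr rfl fun z _ => ?_
    cases hz : z i <;> simp
  rw [smul_comm (e.r true), smul_comm (e.r false), ← smul_add, Finset.smul_sum, Finset.smul_sum,
    ← Finset.sum_add_distrib, ← Finset.sum_congr rfl fun i _ => key i, Finset.smul_sum]
  simp only [Finset.smul_sum]
  rw [Finset.sum_comm]
  exact Finset.sum_congr rfl fun z _ => Finset.sum_congr rfl fun i _ => smul_comm _ _ _

end RandomizedZ

/-!
The rescaled error `√N (θ̂_N - θ_N)` is compared with its linear approximation
`-Ψ̇_N(θ_N)⁻¹ √N Ψ̂_N(θ_N)`, and the latter with the Gaussian law; the triangle inequality for the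
Lévy–Prokhorov distance combines the two.

*Linearization.* Near `θ_N` the derivative of `Ψ̂_N` is uniformly close to that of `Ψ_N`, which is
equicontinuous at `θ_N`. By the mean value inequality the root `θ̂_N` satisfies
`‖Ψ̂_N(θ_N) + Ψ̇_N(θ_N) (θ̂_N - θ_N)‖ ≤ 2 η ‖θ̂_N - θ_N‖` with high probability
(`norm_empPsi_sub_sub_le`). As `σ_min(Ψ̇_N(θ_N))` is bounded below and `√N Ψ̂_N(θ_N)` is bounded in
probability, by an exchangeability computation of its second moment
(`integral_norm_sq_sum_centered_le`), the error and its linear approximation differ by `o_pr(1)`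
(`eventually_measure_dist_linearApprox_le`).

*Central limit theorem.* Since `Ψ_N(θ_N) = 0`, `√N Ψ̂_N(θ_N)` equals `∑ i, (1{Z_i = 1} - r₁) x_i`,
where `x_i` is the unit-level effect `ψ_{1i}(θ_N) - ψ_{0i}(θ_N)`, centred and divided by `√N`
(`sqrt_smul_empPsi`). A completely randomized assignment is a Bernoulli assignment conditioned on
the number of treated units, so that the characteristic function of a scalar statistic
`∑ i, (1{Z_i = 1} - r) b_i` is a ratio of two integrals `∫ ∏ j, φ(s + b_j) ds` over `[-π, π]`, where
`φ` is the characteristic function of a centred Bernoulli variable (`integral_prod_bernChar`). After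
the substitution `s = u / √N` the integrand is asymptotic to
`exp(-r (1 - r) (u ^ 2 + ∑ j, b_j ^ 2) / 2)`, the cross terms vanishing because `∑ j, b_j = 0`, and
it is dominated by a fixed Gaussian function. Dominated convergence therefore gives the limit
`exp(-r (1 - r) ∑ j, b_j ^ 2 / 2)` (`tendsto_integral_exp_sum_centered_sub`).

*Varying covariance.* The sandwich matrices need not converge, but their entries are bounded, so
that every subsequence has a further one along which they do; there Lévy's continuity theorem applies to
both sequences of laws (`tendsto_levyProkhorovEDist_multivariateGaussian`).
-/

namespace RandomizedZ

/-! ### Fourier inversion for simple random sampling -/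

/-- The treatment indicator of a unit with assignment `z`, centred at the treated proportion `r`. -/
noncomputable def centered (r : ℝ) (z : Bool) : ℝ := (if z = true then 1 else 0) - r

/-- The characteristic function of a centred Bernoulli variable with success probability `r`. -/
noncomputable def bernChar (r s : ℝ) : ℂ :=
  r * Complex.exp ((s * centered r true : ℝ) * Complex.I) +
    (1 - r) * Complex.exp ((s * centered r false : ℝ) * Complex.I)

theorem continuous_bernChar (r : ℝ) : Continuous (bernChar r) := by
  unfold bernChar; fun_prop

theorem norm_sq_bernChar (r s : ℝ) :
    ‖bernChar r s‖ ^ 2 = 1 - 2 * (r * (1 - r)) * (1 - Real.cos s) := by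
  have h : bernChar r s = Complex.exp ((-(r * s) : ℝ) * Complex.I) *
      (r * Complex.exp (s * Complex.I) + (1 - r)) := by
    rw [bernChar, mul_add, mul_left_comm, ← Complex.exp_add, mul_comm (Complex.exp _)]
    simp only [centered]
    congr 3
    · push_cast; simp; ring
    · congr 1; push_cast; simp; ring
  rw [h, norm_mul, Complex.norm_exp_ofReal_mul_I, one_mul, ← Complex.normSq_eq_norm_sq,
    Complex.normSq_apply]
  simp only [Complex.add_re, Complex.mul_re, Complex.ofReal_re, Complex.ofReal_im,
    Complex.exp_ofReal_mul_I_re, Complex.exp_ofReal_mul_I_im, Complex.add_im, Complex.mul_im,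
    Complex.sub_re, Complex.sub_im, Complex.one_re, Complex.one_im]
  linear_combination r ^ 2 * Real.sin_sq_add_cos_sq s

theorem norm_bernChar_le_one {r : ℝ} (h0 : 0 ≤ r) (h1 : r ≤ 1) (s : ℝ) : ‖bernChar r s‖ ≤ 1 := by
  have h := norm_sq_bernChar r s
  have h2 : 0 ≤ r * (1 - r) * (1 - Real.cos s) :=
    mul_nonneg (mul_nonneg h0 (by linarith)) (by linarith [Real.cos_le_one s])
  nlinarith [norm_nonneg (bernChar r s)]

/-- A quadratic lower bound for `1 - cos` on an interval extending beyond `[-π, π]`. -/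
theorem sq_div_le_one_sub_cos {x : ℝ} (hx : |x| ≤ 3 * Real.pi / 2) :
    x ^ 2 / 64 ≤ 1 - Real.cos x := by
  have hpi := Real.pi_pos
  have h1 : Real.cos (x / 2) ≤ 1 - 2 / Real.pi ^ 2 * (x / 2) ^ 2 :=
    Real.cos_le_one_sub_mul_cos_sq (by rw [abs_div, abs_two]; linarith)
  have h2 : -(√2 / 2) ≤ Real.cos (x / 2) := by
    rw [← Real.cos_pi_div_four, ← Real.cos_pi_sub, ← Real.cos_abs (x / 2)]
    refine Real.cos_le_cos_of_nonneg_of_le_pi (abs_nonneg _) (by linarith) ?_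
    rw [abs_div, abs_two]; linarith
  have h3 : √2 ≤ 3 / 2 := by
    rw [Real.sqrt_le_left (by norm_num)]; norm_num
  have h4 : Real.cos x = 2 * Real.cos (x / 2) ^ 2 - 1 := by
    rw [← Real.cos_two_mul]; ring_nf
  have h5 : x ^ 2 / 32 ≤ 2 / Real.pi ^ 2 * (x / 2) ^ 2 := by
    have : (1 : ℝ) / 16 ≤ 1 / Real.pi ^ 2 := by
      apply one_div_le_one_div_of_le (by positivity)
      nlinarith [Real.pi_le_four]
    have : 2 / Real.pi ^ 2 * (x / 2) ^ 2 = 1 / Real.pi ^ 2 * (x ^ 2 / 2) := by ring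
    rw [this]; nlinarith [sq_nonneg x]
  have h6 : x ^ 2 / 32 ≤ 1 - Real.cos (x / 2) := by linarith
  nlinarith [sq_nonneg x]

theorem norm_bernChar_le_exp {c r : ℝ} (hc : 0 ≤ c) (h0 : c ≤ r) (h1 : r ≤ 1 - c) {s : ℝ}
    (hs : |s| ≤ 3 * Real.pi / 2) : ‖bernChar r s‖ ≤ Real.exp (-(c ^ 2 / 64) * s ^ 2) := by
  have h := norm_sq_bernChar r s
  have h2 : c ^ 2 ≤ r * (1 - r) := by nlinarith
  have h3 : c ^ 2 * (s ^ 2 / 64) ≤ r * (1 - r) * (1 - Real.cos s) :=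
    mul_le_mul h2 (sq_div_le_one_sub_cos hs) (by positivity) (by nlinarith)
  refine le_of_sq_le_sq ?_ (Real.exp_pos _).le
  rw [← Real.exp_nat_mul, h]
  refine le_trans ?_ (Real.add_one_le_exp _)
  push_cast
  linarith

/-- The second-order expansion of the characteristic function of a centred Bernoulli variable. -/
theorem norm_bernChar_sub_exp_le {r : ℝ} (h0 : 0 ≤ r) (h1 : r ≤ 1) {s : ℝ} (hs : |s| ≤ 1) :
    ‖bernChar r s - (Real.exp (-(r * (1 - r) * s ^ 2 / 2)) : ℝ)‖ ≤ 2 * |s| ^ 3 := by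
  have key : ∀ x : ℝ, |x| ≤ |s| →
      ‖Complex.exp ((x : ℝ) * Complex.I) - (1 + x * Complex.I - x ^ 2 / 2)‖ ≤ |s| ^ 3 := by
    intro x hx
    have hn : ‖(x : ℂ) * Complex.I‖ = |x| := by simp
    have := Complex.exp_bound (x := (x : ℂ) * Complex.I) (by rw [hn]; linarith) (n := 3)
      (by norm_num)
    rw [hn] at this
    have e : ∑ m ∈ Finset.range 3, ((x : ℂ) * Complex.I) ^ m / m.factorial
        = 1 + x * Complex.I - x ^ 2 / 2 := by
      simp [Finset.sum_range_succ, Nat.factorial, mul_pow]; ring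
    rw [e] at this
    refine this.trans ?_
    have : |x| ^ 3 ≤ |s| ^ 3 := by gcongr
    norm_num [Nat.factorial]
    nlinarith [pow_nonneg (abs_nonneg x) 3]
  have ht : |s * centered r true| ≤ |s| := by
    rw [abs_mul]; refine mul_le_of_le_one_right (abs_nonneg _) ?_
    simp only [centered]; rw [abs_le]; constructor <;> simp <;> linarith
  have hf : |s * centered r false| ≤ |s| := by
    rw [abs_mul]; refine mul_le_of_le_one_right (abs_nonneg _) ?_
    simp only [centered]; rw [abs_le]; constructor <;> simp <;> linarith
  have kt := key _ ht
  have kf := key _ hf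
  have hy : ‖((Real.exp (-(r * (1 - r) * s ^ 2 / 2)) - 1 - (-(r * (1 - r) * s ^ 2 / 2)) : ℝ) : ℂ)‖
      ≤ |s| ^ 3 := by
    rw [Complex.norm_real, Real.norm_eq_abs]
    have hv : 0 ≤ r * (1 - r) := mul_nonneg h0 (by linarith)
    have hv1 : r * (1 - r) ≤ 1 := by nlinarith
    have hs2 : s ^ 2 ≤ 1 := by rw [← sq_abs]; nlinarith [abs_nonneg s]
    have hb : r * (1 - r) * s ^ 2 ≤ s ^ 2 := by nlinarith [sq_nonneg s]
    have hb0 : 0 ≤ r * (1 - r) * s ^ 2 := by positivity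
    refine (Real.abs_exp_sub_one_sub_id_le ?_).trans ?_
    · rw [abs_le]; constructor <;> linarith
    · have h4 : (-(r * (1 - r) * s ^ 2 / 2)) ^ 2 ≤ (s ^ 2) ^ 2 := by nlinarith
      refine h4.trans ?_
      rw [← sq_abs s]
      nlinarith [pow_nonneg (abs_nonneg s) 3]
  have e : bernChar r s - (Real.exp (-(r * (1 - r) * s ^ 2 / 2)) : ℝ)
      = r * (Complex.exp ((s * centered r true : ℝ) * Complex.I) -
          (1 + (s * centered r true : ℝ) * Complex.I - (s * centered r true : ℝ) ^ 2 / 2))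
        + (1 - r) * (Complex.exp ((s * centered r false : ℝ) * Complex.I) -
          (1 + (s * centered r false : ℝ) * Complex.I - (s * centered r false : ℝ) ^ 2 / 2))
        - ((Real.exp (-(r * (1 - r) * s ^ 2 / 2)) - 1 - (-(r * (1 - r) * s ^ 2 / 2)) : ℝ) : ℂ) := by
    simp only [bernChar, centered]
    push_cast
    simp
    ring
  rw [e]
  refine (norm_sub_le _ _).trans ?_
  have hn1 : ‖(1 - r : ℂ)‖ = 1 - r := by
    have : (1 - r : ℂ) = ((1 - r : ℝ) : ℂ) := by push_cast; rfl
    rw [this, Complex.norm_real, Real.norm_of_nonneg (by linarith)]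
  have hn0 : ‖(r : ℂ)‖ = r := by rw [Complex.norm_real, Real.norm_of_nonneg h0]
  have := norm_add_le
    (r * (Complex.exp ((s * centered r true : ℝ) * Complex.I) -
          (1 + (s * centered r true : ℝ) * Complex.I - (s * centered r true : ℝ) ^ 2 / 2)))
    ((1 - r) * (Complex.exp ((s * centered r false : ℝ) * Complex.I) -
          (1 + (s * centered r false : ℝ) * Complex.I - (s * centered r false : ℝ) ^ 2 / 2)))
  rw [norm_mul, norm_mul, hn0, hn1] at this
  have a1 := mul_le_mul_of_nonneg_left kt h0
  have a2 := mul_le_mul_of_nonneg_left kf (show 0 ≤ 1 - r by linarith)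
  linarith

theorem norm_prod_sub_prod_le {ι : Type*} (s : Finset ι) (f g : ι → ℂ)
    (hf : ∀ i ∈ s, ‖f i‖ ≤ 1) (hg : ∀ i ∈ s, ‖g i‖ ≤ 1) :
    ‖∏ i ∈ s, f i - ∏ i ∈ s, g i‖ ≤ ∑ i ∈ s, ‖f i - g i‖ := by
  classical
  induction s using Finset.induction_on with
  | empty => simp
  | insert a s ha ih =>
    rw [Finset.prod_insert ha, Finset.prod_insert ha, Finset.sum_insert ha]
    have hp : ‖∏ i ∈ s, f i‖ ≤ 1 := by
      rw [norm_prod]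
      exact Finset.prod_le_one (fun _ _ => norm_nonneg _)
        fun i hi => hf i (Finset.mem_insert_of_mem hi)
    have e : f a * ∏ i ∈ s, f i - g a * ∏ i ∈ s, g i
        = (f a - g a) * ∏ i ∈ s, f i + g a * (∏ i ∈ s, f i - ∏ i ∈ s, g i) := by ring
    rw [e]
    refine (norm_add_le _ _).trans (add_le_add ?_ ?_)
    · rw [norm_mul]; exact mul_le_of_le_one_right (norm_nonneg _) hp
    · rw [norm_mul]
      refine (mul_le_of_le_one_left (norm_nonneg _) (hg a (Finset.mem_insert_self _ _))).trans ?_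
      exact ih (fun i hi => hf i (Finset.mem_insert_of_mem hi))
        fun i hi => hg i (Finset.mem_insert_of_mem hi)

theorem integral_exp_int_mul_I (m : ℤ) :
    ∫ s in (-Real.pi)..Real.pi, Complex.exp ((s * m : ℝ) * Complex.I)
      = if m = 0 then ((2 * Real.pi : ℝ) : ℂ) else 0 := by
  split_ifs with hm
  · subst hm; simp; ring
  · have hc : (m * Complex.I : ℂ) ≠ 0 := mul_ne_zero (by exact_mod_cast hm) Complex.I_ne_zero
    have e : ∀ s : ℝ, Complex.exp ((s * m : ℝ) * Complex.I) = Complex.exp (m * Complex.I * s) := by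
      intro s; congr 1; push_cast; ring
    simp_rw [e]
    rw [integral_exp_mul_complex hc, div_eq_zero_iff]
    left
    rw [sub_eq_zero]
    refine Complex.exp_eq_exp_iff_exists_int.2 ⟨m, ?_⟩
    push_cast; ring

theorem prod_bernWeight {N : ℕ} (r : ℝ) (z : Fin N → Bool) :
    ∏ j, (if z j = true then r else 1 - r) = r ^ numTreated z * (1 - r) ^ (N - numTreated z) := by
  rw [Finset.prod_ite, Finset.prod_const, Finset.prod_const]
  congr 2
  rw [numTreated, Finset.filter_not, Finset.card_sdiff_of_subset (Finset.filter_subset _ _)]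
  simp

theorem sum_centered {N : ℕ} (r : ℝ) (z : Fin N → Bool) :
    ∑ j, centered r (z j) = numTreated z - N * r := by
  simp [centered, Finset.sum_sub_distrib, numTreated]

/-- Bernoulli sampling conditioned on the number of treated units is simple random sampling:
integrating the characteristic function of the Bernoulli sample in the direction of the number of
treated units selects the assignments with exactly `n` treated units. -/
theorem integral_prod_bernChar {N n : ℕ} {r : ℝ} (hr : N * r = n) (b : Fin N → ℝ) :
    ∫ s in (-Real.pi)..Real.pi, ∏ j, bernChar r (s + b j)
      = (2 * Real.pi * (r ^ n * (1 - r) ^ (N - n)) : ℝ) *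
        ∑ z : Fin N → Bool, if numTreated z = n then
          Complex.exp ((∑ j, centered r (z j) * b j : ℝ) * Complex.I) else 0 := by
  have e : ∀ s : ℝ, ∏ j, bernChar r (s + b j) = ∑ z : Fin N → Bool,
      ((r ^ numTreated z * (1 - r) ^ (N - numTreated z) : ℝ) : ℂ) *
        Complex.exp ((∑ j, centered r (z j) * b j : ℝ) * Complex.I) *
        Complex.exp ((s * ((numTreated z - n : ℤ) : ℝ) : ℝ) * Complex.I) := by
    intro s
    have e1 : ∀ j, bernChar r (s + b j) = ∑ k : Bool, ((if k = true then r else 1 - r : ℝ) : ℂ) *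
        Complex.exp (((s + b j) * centered r k : ℝ) * Complex.I) := by
      intro j; simp [bernChar]
    rw [Finset.prod_congr rfl fun j _ => e1 j, Fintype.prod_sum]
    refine Finset.sum_congr rfl fun z _ => ?_
    rw [Finset.prod_mul_distrib, ← Complex.exp_sum, ← Complex.ofReal_prod, prod_bernWeight,
      mul_assoc, ← Complex.exp_add, ← Finset.sum_mul, ← Complex.ofReal_sum, ← add_mul,
      ← Complex.ofReal_add]
    congr 5
    simp_rw [add_mul]
    rw [Finset.sum_add_distrib, ← Finset.mul_sum, sum_centered, hr, add_comm]
    push_cast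
    congr 1
    exact Finset.sum_congr rfl fun _ _ => mul_comm _ _
  simp_rw [e]
  rw [intervalIntegral.integral_finsetSum]
  · rw [Finset.mul_sum]
    refine Finset.sum_congr rfl fun z _ => ?_
    rw [intervalIntegral.integral_const_mul, integral_exp_int_mul_I]
    by_cases h : numTreated z = n
    · simp only [h, sub_self, if_true]; push_cast; ring
    · have : (numTreated z - n : ℤ) ≠ 0 := by omega
      simp [h, this]
  · intro z _
    apply Continuous.intervalIntegrable
    fun_prop

/-! ### A central limit theorem for simple random sampling -/

/-- Pointwise convergence of the integrand in the Fourier inversion formula. -/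
theorem tendsto_prod_bernChar_sub {r M : ℕ → ℝ} {b : ∀ N, Fin N → ℝ} {B : ℝ}
    (hr0 : ∀ᶠ N in atTop, 0 ≤ r N) (hr1 : ∀ᶠ N in atTop, r N ≤ 1)
    (hsum : ∀ᶠ N in atTop, ∑ j, b N j = 0) (hB : ∀ᶠ N in atTop, ∑ j, b N j ^ 2 ≤ B)
    (hM : Tendsto M atTop (𝓝 0)) (hbM : ∀ᶠ N in atTop, ∀ j, |b N j| ≤ M N) (u : ℝ) :
    Tendsto (fun N : ℕ => ∏ j, bernChar (r N) (u / √(N : ℝ) + b N j)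
      - (Real.exp (-(r N * (1 - r N) / 2) * (u ^ 2 + ∑ j, b N j ^ 2)) : ℝ)) atTop (𝓝 0) := by
  have hu : Tendsto (fun N : ℕ => |u| / √(N : ℝ) + M N) atTop (𝓝 0) := by
    have h1 : Tendsto (fun N : ℕ => √(N : ℝ)) atTop atTop :=
      Real.tendsto_sqrt_atTop.comp tendsto_natCast_atTop_atTop
    simpa using (h1.const_div_atTop |u|).add hM
  have hlim : Tendsto (fun N : ℕ => 2 * (|u| / √(N : ℝ) + M N) * (u ^ 2 + B)) atTop (𝓝 0) := by
    simpa using (hu.const_mul 2).mul_const (u ^ 2 + B)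
  rw [tendsto_zero_iff_norm_tendsto_zero]
  refine squeeze_zero' (Eventually.of_forall fun _ => norm_nonneg _) ?_ hlim
  filter_upwards [hr0, hr1, hsum, hB, hbM, hu.eventually_le_const (show (0 : ℝ) < 1 by norm_num),
    eventually_gt_atTop 0] with N h0 h1 hs hb hm hsmall hN
  have hNpos : (0 : ℝ) < N := by exact_mod_cast hN
  set s : Fin N → ℝ := fun j => u / √(N : ℝ) + b N j with hsdef
  have hs2 : ∑ j, s j ^ 2 = u ^ 2 + ∑ j, b N j ^ 2 := by
    simp only [hsdef, add_sq, Finset.sum_add_distrib, ← Finset.mul_sum, hs]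
    simp [div_pow, Real.sq_sqrt hNpos.le]
    field_simp
  have hsj : ∀ j, |s j| ≤ |u| / √(N : ℝ) + M N := fun j => by
    refine (abs_add_le _ _).trans (add_le_add ?_ (hm j))
    rw [abs_div, abs_of_nonneg (Real.sqrt_nonneg _)]
  have hexp : ((Real.exp (-(r N * (1 - r N) / 2) * (u ^ 2 + ∑ j, b N j ^ 2)) : ℝ) : ℂ)
      = ∏ j, ((Real.exp (-(r N * (1 - r N) * s j ^ 2 / 2)) : ℝ) : ℂ) := by
    rw [← Complex.ofReal_prod, ← Real.exp_sum, ← hs2, Finset.mul_sum]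
    congr 3
    funext j
    ring
  rw [hexp]
  refine (norm_prod_sub_prod_le _ _ _ (fun j _ => norm_bernChar_le_one h0 h1 _) ?_).trans ?_
  · intro j _
    rw [Complex.norm_real, Real.norm_of_nonneg (Real.exp_pos _).le, Real.exp_le_one_iff]
    have : 0 ≤ r N * (1 - r N) := mul_nonneg h0 (by linarith)
    nlinarith [sq_nonneg (s j)]
  · calc _ ≤ ∑ j, 2 * (|u| / √(N : ℝ) + M N) * s j ^ 2 := by
          refine Finset.sum_le_sum fun j _ => ?_
          refine (norm_bernChar_sub_exp_le h0 h1 ((hsj j).trans hsmall)).trans ?_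
          rw [← sq_abs (s j)]
          nlinarith [hsj j, sq_nonneg |s j|]
      _ = 2 * (|u| / √(N : ℝ) + M N) * (u ^ 2 + ∑ j, b N j ^ 2) := by
          rw [← Finset.mul_sum, hs2]
      _ ≤ _ := by
          have : 0 ≤ |u| / √(N : ℝ) + M N := (abs_nonneg _).trans (hsj ⟨0, hN⟩)
          gcongr

/-- The integrand in the Fourier inversion formula is dominated by a fixed Gaussian function. -/
theorem norm_prod_bernChar_le {N : ℕ} (hN : 0 < N) {c r u : ℝ} (hc : 0 ≤ c) (h0 : c ≤ r)
    (h1 : r ≤ 1 - c) {b : Fin N → ℝ} (hsum : ∑ j, b j = 0) (hb : ∀ j, |b j| ≤ 1)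
    (hu : |u| ≤ Real.pi * √(N : ℝ)) :
    ‖∏ j, bernChar r (u / √(N : ℝ) + b j)‖ ≤ Real.exp (-(c ^ 2 / 64) * u ^ 2) := by
  have hNpos : (0 : ℝ) < N := by exact_mod_cast hN
  have hs2 : ∑ j, (u / √(N : ℝ) + b j) ^ 2 = u ^ 2 + ∑ j, b j ^ 2 := by
    simp only [add_sq, Finset.sum_add_distrib, ← Finset.mul_sum, hsum]
    simp [div_pow, Real.sq_sqrt hNpos.le]
    field_simp
  rw [norm_prod]
  calc _ ≤ ∏ j, Real.exp (-(c ^ 2 / 64) * (u / √(N : ℝ) + b j) ^ 2) := by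
        refine Finset.prod_le_prod (fun _ _ => norm_nonneg _) fun j _ =>
          norm_bernChar_le_exp hc h0 h1 ?_
        have : |u / √(N : ℝ)| ≤ Real.pi := by
          rw [abs_div, abs_of_nonneg (Real.sqrt_nonneg _), div_le_iff₀ (Real.sqrt_pos.2 hNpos)]
          exact hu
        have := abs_add_le (u / √(N : ℝ)) (b j)
        linarith [hb j, Real.pi_gt_three]
    _ = Real.exp (-(c ^ 2 / 64) * (u ^ 2 + ∑ j, b j ^ 2)) := by
        rw [← Real.exp_sum, ← Finset.mul_sum, hs2]
    _ ≤ _ := by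
        refine Real.exp_le_exp.2 ?_
        have : 0 ≤ ∑ j, b j ^ 2 := Finset.sum_nonneg fun _ _ => sq_nonneg _
        have : 0 ≤ c ^ 2 / 64 * ∑ j, b j ^ 2 := by positivity
        linarith

/-- A local limit theorem: the rescaled Fourier inversion integral is asymptotic to the
corresponding Gaussian integral. -/
theorem tendsto_integral_prod_bernChar_sub {c : ℝ} (hc : 0 < c) {r M : ℕ → ℝ}
    {b : ∀ N, Fin N → ℝ} {B : ℝ}
    (hr0 : ∀ᶠ N in atTop, c ≤ r N) (hr1 : ∀ᶠ N in atTop, r N ≤ 1 - c)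
    (hsum : ∀ᶠ N in atTop, ∑ j, b N j = 0) (hB : ∀ᶠ N in atTop, ∑ j, b N j ^ 2 ≤ B)
    (hM : Tendsto M atTop (𝓝 0)) (hbM : ∀ᶠ N in atTop, ∀ j, |b N j| ≤ M N) :
    Tendsto (fun N : ℕ => √(N : ℝ) * (∫ s in (-Real.pi)..Real.pi, ∏ j, bernChar (r N) (s + b N j))
      - (Real.exp (-(r N * (1 - r N) / 2) * ∑ j, b N j ^ 2) *
          √(Real.pi / (r N * (1 - r N) / 2)) : ℝ)) atTop (𝓝 0) := by
  set G : ℕ → ℝ → ℂ := fun N u =>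
    (Real.exp (-(r N * (1 - r N) / 2) * (u ^ 2 + ∑ j, b N j ^ 2)) : ℝ) with hG
  set F : ℕ → ℝ → ℂ := fun N => (Set.Ioc (-(Real.pi * √(N : ℝ))) (Real.pi * √(N : ℝ))).indicator
    fun u => ∏ j, bernChar (r N) (u / √(N : ℝ) + b N j) with hF
  have hc2 : 0 < c ^ 2 / 64 := by positivity
  have hv : ∀ᶠ N in atTop, c ^ 2 ≤ r N * (1 - r N) := by
    filter_upwards [hr0, hr1] with N h0 h1
    nlinarith
  have hGle : ∀ᶠ N in atTop, ∀ u, ‖G N u‖ ≤ Real.exp (-(c ^ 2 / 64) * u ^ 2) := by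
    filter_upwards [hv] with N h u
    rw [hG, Complex.norm_real, Real.norm_of_nonneg (Real.exp_pos _).le]
    refine Real.exp_le_exp.2 ?_
    have h1 : 0 ≤ ∑ j, b N j ^ 2 := Finset.sum_nonneg fun _ _ => sq_nonneg _
    have h2 : 0 ≤ r N * (1 - r N) / 2 * ∑ j, b N j ^ 2 :=
      mul_nonneg (by nlinarith [sq_nonneg c]) h1
    nlinarith [mul_le_mul_of_nonneg_right h (sq_nonneg u), mul_nonneg (sq_nonneg c) (sq_nonneg u)]
  have hFle : ∀ᶠ N in atTop, ∀ u, ‖F N u‖ ≤ Real.exp (-(c ^ 2 / 64) * u ^ 2) := by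
    filter_upwards [hr0, hr1, hsum, hbM, hM.eventually_le_const (show (0 : ℝ) < 1 by norm_num),
      eventually_gt_atTop 0] with N h0 h1 hs hm hM1 hN u
    rw [hF]
    by_cases hu : u ∈ Set.Ioc (-(Real.pi * √(N : ℝ))) (Real.pi * √(N : ℝ))
    · simp only [Set.indicator_of_mem hu]
      exact norm_prod_bernChar_le hN hc.le h0 h1 hs (fun j => (hm j).trans hM1)
        (abs_le.2 ⟨hu.1.le, hu.2⟩)
    · simp only [Set.indicator_of_notMem hu, norm_zero]
      exact (Real.exp_pos _).le
  have hGc : ∀ N, Continuous (G N) := fun N => by simp only [hG]; fun_prop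
  have hFm : ∀ N, AEStronglyMeasurable (F N) volume := fun N => by
    refine AEStronglyMeasurable.indicator ?_ measurableSet_Ioc
    have : Continuous fun u : ℝ => ∏ j, bernChar (r N) (u / √(N : ℝ) + b N j) :=
      continuous_finsetProd _ fun j _ => (continuous_bernChar _).comp (by fun_prop)
    exact this.aestronglyMeasurable
  have hdom : Integrable (fun u : ℝ => Real.exp (-(c ^ 2 / 64) * u ^ 2)) volume :=
    integrable_exp_neg_mul_sq hc2
  have key : Tendsto (fun N => ∫ u, (F N u - G N u)) atTop (𝓝 (∫ _ : ℝ, (0 : ℂ))) := by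
    refine tendsto_integral_filter_of_dominated_convergence
      (fun u => 2 * Real.exp (-(c ^ 2 / 64) * u ^ 2)) ?_ ?_ (hdom.const_mul 2) ?_
    · exact Eventually.of_forall fun N => (hFm N).sub (hGc N).aestronglyMeasurable
    · filter_upwards [hGle, hFle] with N hg hf
      refine Eventually.of_forall fun u => ?_
      refine (norm_sub_le _ _).trans ?_
      linarith [hg u, hf u]
    · refine Eventually.of_forall fun u => ?_
      have hp := tendsto_prod_bernChar_sub (hr0.mono fun N h => hc.le.trans h)
        (hr1.mono fun N h => h.trans (by linarith)) hsum hB hM hbM u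
      refine hp.congr' ?_
      have h1 : Tendsto (fun N : ℕ => Real.pi * √(N : ℝ)) atTop atTop :=
        (Real.tendsto_sqrt_atTop.comp tendsto_natCast_atTop_atTop).const_mul_atTop Real.pi_pos
      filter_upwards [h1.eventually_gt_atTop |u|] with N hN
      have hu : u ∈ Set.Ioc (-(Real.pi * √(N : ℝ))) (Real.pi * √(N : ℝ)) :=
        ⟨(abs_lt.1 hN).1, (abs_lt.1 hN).2.le⟩
      simp only [hF, hG, Set.indicator_of_mem hu]
  rw [integral_zero] at key
  refine key.congr' ?_
  filter_upwards [hGle, hFle, hv, eventually_gt_atTop 0] with N hg hf hvN hN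
  have hNpos : (0 : ℝ) < √(N : ℝ) := Real.sqrt_pos.2 (by exact_mod_cast hN)
  have iF : Integrable (F N) := hdom.mono' (hFm N) (Eventually.of_forall hf)
  have iG : Integrable (G N) := hdom.mono' (hGc N).aestronglyMeasurable (Eventually.of_forall hg)
  rw [integral_sub iF iG]
  congr 1
  · rw [hF, integral_indicator measurableSet_Ioc, ← intervalIntegral.integral_of_le
      (by nlinarith [Real.pi_pos, mul_pos Real.pi_pos hNpos]),
      intervalIntegral.integral_comp_div (fun s => ∏ j, bernChar (r N) (s + b N j)) hNpos.ne',
      neg_div, mul_div_cancel_right₀ _ hNpos.ne', Complex.real_smul]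
  · rw [hG, integral_complex_ofReal]
    congr 1
    have : ∀ u : ℝ, Real.exp (-(r N * (1 - r N) / 2) * (u ^ 2 + ∑ j, b N j ^ 2))
        = Real.exp (-(r N * (1 - r N) / 2) * ∑ j, b N j ^ 2) *
          Real.exp (-(r N * (1 - r N) / 2) * u ^ 2) := fun u => by
      rw [← Real.exp_add]; ring_nf
    simp_rw [this]
    rw [integral_const_mul, integral_gaussian]

/-- **Central limit theorem for completely randomized experiments**, at the level of characteristic
functions: a linear statistic of the assignment with negligible coefficients is asymptotically
normal. The variance may be degenerate. -/
theorem tendsto_integral_exp_sum_centered_sub {Ω : ℕ → Type*} [∀ N, MeasurableSpace (Ω N)]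
    {P : ∀ N, Measure (Ω N)} [∀ N, IsProbabilityMeasure (P N)] {Z : ∀ N, Ω N → Fin N → Bool}
    {n : ℕ → ℕ} {c : ℝ} (hc : 0 < c) {r M : ℕ → ℝ} {b : ∀ N, Fin N → ℝ} {B : ℝ}
    (hZ : ∀ᶠ N in atTop, IsCRE (P N) (n N) (Z N)) (hn : ∀ᶠ N in atTop, N * r N = n N)
    (hr0 : ∀ᶠ N in atTop, c ≤ r N) (hr1 : ∀ᶠ N in atTop, r N ≤ 1 - c)
    (hsum : ∀ᶠ N in atTop, ∑ j, b N j = 0) (hB : ∀ᶠ N in atTop, ∑ j, b N j ^ 2 ≤ B)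
    (hM : Tendsto M atTop (𝓝 0)) (hbM : ∀ᶠ N in atTop, ∀ j, |b N j| ≤ M N) :
    Tendsto (fun N : ℕ =>
      ∫ ω, Complex.exp ((∑ j, centered (r N) (Z N ω j) * b N j : ℝ) * Complex.I) ∂(P N)
      - (Real.exp (-(r N * (1 - r N) / 2) * ∑ j, b N j ^ 2) : ℝ)) atTop (𝓝 0) := by
  have hx := tendsto_integral_prod_bernChar_sub hc hr0 hr1 hsum hB hM hbM
  have hy := tendsto_integral_prod_bernChar_sub (b := fun _ _ => 0) (B := 0) (M := fun _ => 0) hc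
    hr0 hr1 (by simp) (by simp) tendsto_const_nhds (by simp)
  simp only [add_zero, ne_eq, OfNat.ofNat_ne_zero, not_false_eq_true, zero_pow,
    Finset.sum_const_zero, mul_zero, Real.exp_zero, one_mul] at hy
  set x : ℕ → ℂ := fun N =>
    √(N : ℝ) * ∫ s in (-Real.pi)..Real.pi, ∏ j, bernChar (r N) (s + b N j) with hxdef
  set y : ℕ → ℂ := fun N =>
    √(N : ℝ) * ∫ s in (-Real.pi)..Real.pi, ∏ j : Fin N, bernChar (r N) s with hydef
  set E : ℕ → ℝ := fun N => Real.exp (-(r N * (1 - r N) / 2) * ∑ j, b N j ^ 2) with hE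
  set g : ℕ → ℝ := fun N => √(Real.pi / (r N * (1 - r N) / 2)) with hg
  replace hx : Tendsto (fun N => x N - (E N * g N : ℝ)) atTop (𝓝 0) := hx
  replace hy : Tendsto (fun N => y N - (g N : ℝ)) atTop (𝓝 0) := hy
  have hv : ∀ᶠ N in atTop, 0 ≤ r N * (1 - r N) := by
    filter_upwards [hr0, hr1] with N h0 h1
    exact mul_nonneg (hc.le.trans h0) (by linarith)
  have hE1 : ∀ᶠ N in atTop, ‖(E N : ℂ)‖ ≤ 1 := by
    filter_upwards [hv] with N h
    rw [Complex.norm_real, Real.norm_of_nonneg (Real.exp_pos _).le]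
    refine Real.exp_le_one_iff.2 ?_
    have : 0 ≤ ∑ j, b N j ^ 2 := Finset.sum_nonneg fun _ _ => sq_nonneg _
    have := mul_nonneg h this
    linarith
  have hg1 : ∀ᶠ N in atTop, 1 ≤ g N := by
    filter_upwards [hr0, hr1] with N h0 h1
    rw [hg, Real.one_le_sqrt, one_le_div (by nlinarith)]
    nlinarith [Real.pi_gt_three, sq_nonneg (2 * r N - 1)]
  have hnum : Tendsto (fun N => x N - E N * y N) atTop (𝓝 0) := by
    have h2 : Tendsto (fun N => (E N : ℂ) * (y N - g N)) atTop (𝓝 0) := by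
      rw [tendsto_zero_iff_norm_tendsto_zero] at hy ⊢
      refine squeeze_zero' (Eventually.of_forall fun _ => norm_nonneg _) ?_ hy
      filter_upwards [hE1] with N h
      rw [norm_mul]
      exact mul_le_of_le_one_left (norm_nonneg _) h
    have := hx.sub h2
    rw [sub_zero] at this
    refine this.congr fun N => ?_
    push_cast
    ring
  have hy2 : ∀ᶠ N in atTop, 1 / 2 ≤ ‖y N‖ := by
    have := (tendsto_zero_iff_norm_tendsto_zero.1 hy).eventually_le_const
      (show (0 : ℝ) < 1 / 2 by norm_num)
    filter_upwards [this, hg1] with N h1 h2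
    have h3 : ‖(g N : ℂ)‖ ≤ ‖y N‖ + ‖y N - g N‖ := by
      have := norm_sub_le (y N) (y N - g N)
      simpa using this
    rw [Complex.norm_real, Real.norm_eq_abs] at h3
    linarith [le_abs_self (g N)]
  -- The characteristic function is `x N / y N`, and `y N` stays away from `0`.
  have hlim : Tendsto (fun N => (x N - E N * y N) / y N) atTop (𝓝 0) := by
    rw [tendsto_zero_iff_norm_tendsto_zero] at hnum ⊢
    refine squeeze_zero' (Eventually.of_forall fun _ => norm_nonneg _) ?_
      (by simpa using hnum.const_mul 2)
    filter_upwards [hy2] with N h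
    rw [norm_div, div_le_iff₀ (by linarith)]
    nlinarith [norm_nonneg (x N - E N * y N)]
  refine hlim.congr' ?_
  filter_upwards [hy2, hZ, hn] with N hyN hZN hnN
  have hy0 : y N ≠ 0 := norm_pos_iff.1 (by linarith)
  rw [sub_div, mul_div_cancel_right₀ _ hy0]
  congr 1
  rw [div_eq_iff hy0, hZN.integral_eq
    (fun z => Complex.exp ((∑ j, centered (r N) (z j) * b N j : ℝ) * Complex.I))]
  have hx' : x N = √(N : ℝ) * ((2 * Real.pi * (r N ^ n N * (1 - r N) ^ (N - n N)) : ℝ) *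
      ∑ z : Fin N → Bool, if numTreated z = n N then
        Complex.exp ((∑ j, centered (r N) (z j) * b N j : ℝ) * Complex.I) else 0) := by
    rw [hxdef, ← integral_prod_bernChar hnN]
  have hy' : y N = √(N : ℝ) * ((2 * Real.pi * (r N ^ n N * (1 - r N) ^ (N - n N)) : ℝ) *
      ∑ z : Fin N → Bool, if numTreated z = n N then 1 else 0) := by
    have := integral_prod_bernChar hnN (fun _ => 0)
    simp only [add_zero, mul_zero, Finset.sum_const_zero, Complex.ofReal_zero, zero_mul,
      Complex.exp_zero] at this
    rw [hydef, ← this]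
  have hone : ∑ z, (P N).real (Z N ⁻¹' {z}) = 1 := by
    have := hZN.integral_eq (fun _ => (1 : ℝ))
    simpa using this.symm
  simp_rw [hZN.real_eq] at hone ⊢
  have hK : ((((N.choose (n N) : ℕ) : ℝ)⁻¹ : ℝ) : ℂ) *
      (∑ z : Fin N → Bool, if numTreated z = n N then 1 else 0) = 1 := by
    refine Eq.trans ?_ (congrArg Complex.ofReal hone)
    rw [Finset.mul_sum, Complex.ofReal_sum]
    refine Finset.sum_congr rfl fun z _ => ?_
    split_ifs <;> simp
  have hS : ∑ z : Fin N → Bool, (if numTreated z = n N then ((N.choose (n N) : ℕ) : ℝ)⁻¹ else 0) •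
        Complex.exp ((∑ j, centered (r N) (z j) * b N j : ℝ) * Complex.I)
      = ((((N.choose (n N) : ℕ) : ℝ)⁻¹ : ℝ) : ℂ) * ∑ z : Fin N → Bool, if numTreated z = n N then
        Complex.exp ((∑ j, centered (r N) (z j) * b N j : ℝ) * Complex.I) else 0 := by
    rw [Finset.mul_sum]
    refine Finset.sum_congr rfl fun z _ => ?_
    split_ifs <;> simp
  rw [hS, hx', hy']
  linear_combination (-(√(N : ℝ) : ℂ) * (2 * Real.pi * (r N ^ n N * (1 - r N) ^ (N - n N)) : ℝ) *
    ∑ z : Fin N → Bool, if numTreated z = n N then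
        Complex.exp ((∑ j, centered (r N) (z j) * b N j : ℝ) * Complex.I) else 0) * hK

/-! ### The Lévy–Prokhorov distance -/

/-- Two random vectors on the same space which are within `κ` of each other except on an event of
probability `κ` have laws at Lévy–Prokhorov distance at most `κ`. -/
theorem levyProkhorovEDist_map_le {Ω E : Type*} [MeasurableSpace Ω] {P : Measure Ω}
    [PseudoMetricSpace E] [MeasurableSpace E] [BorelSpace E] {X Y : Ω → E}
    (hX : AEMeasurable X P) (hY : AEMeasurable Y P) {κ : ℝ}
    (h : P {ω | κ ≤ dist (X ω) (Y ω)} ≤ ENNReal.ofReal κ) :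
    levyProkhorovEDist (P.map X) (P.map Y) ≤ ENNReal.ofReal κ := by
  have key : ∀ {X Y : Ω → E}, AEMeasurable X P → AEMeasurable Y P →
      P {ω | κ ≤ dist (X ω) (Y ω)} ≤ ENNReal.ofReal κ →
      ∀ (ε : ℝ≥0∞) (B : Set E), ENNReal.ofReal κ < ε → ε < ⊤ → MeasurableSet B →
        P.map X B ≤ P.map Y (Metric.thickening ε.toReal B) + ε := by
    intro X Y hX hY h ε B hε hεt hB
    rw [Measure.map_apply_of_aemeasurable hX hB,
      Measure.map_apply_of_aemeasurable hY Metric.isOpen_thickening.measurableSet]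
    have hsub : X ⁻¹' B ⊆ Y ⁻¹' Metric.thickening ε.toReal B ∪ {ω | κ ≤ dist (X ω) (Y ω)} := by
      intro ω hω
      by_cases hd : κ ≤ dist (X ω) (Y ω)
      · exact Or.inr hd
      · refine Or.inl (Metric.mem_thickening_iff.2 ⟨X ω, hω, ?_⟩)
        rw [dist_comm]
        refine (not_le.1 hd).trans_le ?_
        rw [← ENNReal.ofReal_le_iff_le_toReal hεt.ne]
        exact hε.le
    exact (measure_mono hsub).trans ((measure_union_le _ _).trans (by gcongr; exact h.trans hε.le))
  refine levyProkhorovEDist_le_of_forall _ _ _ fun ε B hε hεt hB =>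
    ⟨key hX hY h ε B hε hεt hB, key hY hX ?_ ε B hε hεt hB⟩
  simpa only [dist_comm] using h

theorem posSemidef_of_tendsto {ι : Type*} {p : ℕ} {l : Filter ι} [l.NeBot]
    {S : ι → Matrix (Fin p) (Fin p) ℝ} {T : Matrix (Fin p) (Fin p) ℝ}
    (hS : ∀ᶠ i in l, (S i).PosSemidef) (hT : Tendsto S l (𝓝 T)) : T.PosSemidef := by
  have hherm : T.IsHermitian := by
    have h1 : Tendsto (fun i => (S i).conjTranspose) l (𝓝 T.conjTranspose) :=
      (Continuous.matrix_conjTranspose continuous_id).continuousAt.tendsto.comp hT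
    refine tendsto_nhds_unique h1 (hT.congr' ?_)
    filter_upwards [hS] with i hi
    exact hi.1.symm
  refine Matrix.PosSemidef.of_dotProduct_mulVec_nonneg hherm fun x => ?_
  have hc : Continuous fun A : Matrix (Fin p) (Fin p) ℝ => star x ⬝ᵥ A.mulVec x := by fun_prop
  refine ge_of_tendsto (hc.continuousAt.tendsto.comp hT) ?_
  filter_upwards [hS] with i hi
  exact hi.dotProduct_mulVec_nonneg x

theorem tendsto_levyProkhorovEDist_of_tendsto {E : Type*} [PseudoMetricSpace E]
    [SecondCountableTopology E] [MeasurableSpace E] [BorelSpace E]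
    {μ ν : ℕ → ProbabilityMeasure E} {ξ : ProbabilityMeasure E}
    (hμ : Tendsto μ atTop (𝓝 ξ)) (hν : Tendsto ν atTop (𝓝 ξ)) :
    Tendsto (fun n => levyProkhorovEDist (μ n : Measure E) (ν n)) atTop (𝓝 0) := by
  have key : ∀ {μ : ℕ → ProbabilityMeasure E}, Tendsto μ atTop (𝓝 ξ) →
      Tendsto (fun n => levyProkhorovEDist (μ n : Measure E) ξ) atTop (𝓝 0) := by
    intro μ hμ
    have h := ((LevyProkhorov.probabilityMeasureHomeomorph (Ω := E)).continuous.tendsto ξ).comp hμ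
    rw [tendsto_iff_edist_tendsto_0] at h
    exact h
  have h := (key hμ).add (key hν)
  rw [add_zero] at h
  refine tendsto_of_tendsto_of_tendsto_of_le_of_le tendsto_const_nhds h (fun _ => zero_le)
    fun n => ?_
  refine (levyProkhorovEDist_triangle _ (ξ : Measure E) _).trans ?_
  rw [levyProkhorovEDist_comm (ξ : Measure E)]

/-- A form of Lévy's continuity theorem in which the approximating Gaussian law varies: since the
covariance matrices are bounded, every subsequence has a further subsequence along which they
converge, and there Lévy's theorem applies to both sequences of laws. -/
theorem tendsto_levyProkhorovEDist_multivariateGaussian {p : ℕ} {μ : ℕ → Measure (Vec p)}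
    [∀ N, IsProbabilityMeasure (μ N)] {S : ℕ → Matrix (Fin p) (Fin p) ℝ} {K : ℝ}
    (hS : ∀ᶠ N in atTop, (S N).PosSemidef) (hK : ∀ᶠ N in atTop, ∀ i j, |S N i j| ≤ K)
    (h : ∀ t : Vec p, Tendsto (fun N => charFun (μ N) t
      - Complex.exp (-(t.ofLp ⬝ᵥ (S N).mulVec t.ofLp : ℝ) / 2)) atTop (𝓝 0)) :
    Tendsto (fun N => levyProkhorovEDist (μ N) (multivariateGaussian 0 (S N))) atTop (𝓝 0) := by
  refine tendsto_of_subseq_tendsto fun ns hns => ?_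
  have hcomp : IsCompact
      (Set.univ.pi fun _ : Fin p => Set.univ.pi fun _ : Fin p => Set.Icc (-K) K) :=
    isCompact_univ_pi fun _ => isCompact_univ_pi fun _ => isCompact_Icc
  have hmem : ∀ᶠ n in atTop, (S (ns n) : Fin p → Fin p → ℝ) ∈
      Set.univ.pi fun _ : Fin p => Set.univ.pi fun _ : Fin p => Set.Icc (-K) K := by
    filter_upwards [hns.eventually hK] with n hn i _ j _
    exact abs_le.1 (hn i j)
  obtain ⟨T, -, φ, hφ, hT⟩ := hcomp.tendsto_subseq' hmem.frequently
  refine ⟨φ, ?_⟩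
  have hsub : Tendsto (fun n => ns (φ n)) atTop atTop := hns.comp hφ.tendsto_atTop
  have hT' : Tendsto (fun n => S (ns (φ n))) atTop (𝓝 (Matrix.of T)) := hT
  have hTpos : (Matrix.of T).PosSemidef := posSemidef_of_tendsto (hsub.eventually hS) hT'
  have hexp : ∀ t : Vec p, Tendsto
      (fun n => Complex.exp (-(t.ofLp ⬝ᵥ (S (ns (φ n))).mulVec t.ofLp : ℝ) / 2)) atTop
      (𝓝 (Complex.exp (-(t.ofLp ⬝ᵥ (Matrix.of T).mulVec t.ofLp : ℝ) / 2))) := by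
    intro t
    have hc : Continuous fun A : Matrix (Fin p) (Fin p) ℝ =>
        Complex.exp (-(t.ofLp ⬝ᵥ A.mulVec t.ofLp : ℝ) / 2) := by fun_prop
    exact hc.continuousAt.tendsto.comp hT'
  have hgauss : ∀ {A : Matrix (Fin p) (Fin p) ℝ}, A.PosSemidef → ∀ t : Vec p,
      charFun (multivariateGaussian 0 A) t
        = Complex.exp (-(t.ofLp ⬝ᵥ A.mulVec t.ofLp : ℝ) / 2) := by
    intro A hA t
    rw [charFun_multivariateGaussian hA, inner_zero_right]
    congr 1
    simp [neg_div]
  refine tendsto_levyProkhorovEDist_of_tendsto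
    (μ := fun n => ⟨μ (ns (φ n)), inferInstance⟩)
    (ν := fun n => ⟨multivariateGaussian 0 (S (ns (φ n))), inferInstance⟩)
    (ξ := ⟨multivariateGaussian 0 (Matrix.of T), inferInstance⟩) ?_ ?_
  · refine ProbabilityMeasure.tendsto_of_tendsto_charFun fun t => ?_
    have := ((h t).comp hsub).add (hexp t)
    simpa [hgauss hTpos] using this
  · refine ProbabilityMeasure.tendsto_of_tendsto_charFun fun t => ?_
    simp only [ProbabilityMeasure.coe_mk, hgauss hTpos]
    refine (hexp t).congr' ?_
    filter_upwards [hsub.eventually hS] with n hn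
    rw [hgauss hn]

/-! ### Second moments under complete randomization -/

theorem abs_centered_le_one {r : ℝ} (h0 : 0 ≤ r) (h1 : r ≤ 1) (z : Bool) : |centered r z| ≤ 1 := by
  unfold centered; rw [abs_le]; split_ifs <;> constructor <;> linarith

/-- By exchangeability of the units, `E (ζ_i ζ_j)` is the same for all `i ≠ j` (with `j` fixed), so
the cross terms in the second moment cancel up to diagonal ones. -/
theorem integral_norm_sq_sum_centered_le {Ω E : Type*} [MeasurableSpace Ω] {P : Measure Ω}
    [IsProbabilityMeasure P] [NormedAddCommGroup E] [InnerProductSpace ℝ E] {N n : ℕ}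
    {Z : Ω → Fin N → Bool} (hZ : IsCRE P n Z) {r : ℝ} (h0 : 0 ≤ r) (h1 : r ≤ 1) {v : Fin N → E}
    (hv : ∑ i, v i = 0) :
    ∫ ω, ‖∑ i, centered r (Z ω i) • v i‖ ^ 2 ∂P ≤ 2 * ∑ i, ‖v i‖ ^ 2 := by
  rw [hZ.integral_eq (fun z => ‖∑ i, centered r (z i) • v i‖ ^ 2)]
  set g : Fin N → Fin N → ℝ := fun i j =>
    ∑ z, P.real (Z ⁻¹' {z}) * (centered r (z i) * centered r (z j)) with hg
  have hone : ∑ z, P.real (Z ⁻¹' {z}) = 1 := by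
    have := hZ.integral_eq (fun _ => (1 : ℝ))
    simpa using this.symm
  have hgle : ∀ i j, |g i j| ≤ 1 := by
    intro i j
    rw [← hone]
    refine (Finset.abs_sum_le_sum_abs _ _).trans (Finset.sum_le_sum fun z _ => ?_)
    rw [abs_mul, abs_mul, abs_of_nonneg measureReal_nonneg]
    refine mul_le_of_le_one_right measureReal_nonneg ?_
    exact mul_le_one₀ (abs_centered_le_one h0 h1 _) (abs_nonneg _) (abs_centered_le_one h0 h1 _)
  have hsym : ∀ i i' j, i ≠ j → i' ≠ j → g i j = g i' j := by
    intro i i' j hi hi'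
    refine Fintype.sum_equiv ((Equiv.swap i i').arrowCongr (Equiv.refl Bool)) _ _ fun z => ?_
    have e1 : ((Equiv.swap i i').arrowCongr (Equiv.refl Bool)) z = z ∘ Equiv.swap i i' := by
      ext k; simp
    rw [e1, hZ.real_eq, hZ.real_eq, numTreated_comp]
    simp [Equiv.swap_apply_of_ne_of_ne hi.symm hi'.symm]
  have hβ : ∀ j, ∃ β : ℝ, |β| ≤ 1 ∧ ∀ i, i ≠ j → g i j = β := by
    intro j
    by_cases hj : ∃ i, i ≠ j
    · obtain ⟨i, hi⟩ := hj
      exact ⟨g i j, hgle i j, fun i' hi' => hsym i' i j hi' hi⟩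
    · exact ⟨0, by simp, fun i hi => (hj ⟨i, hi⟩).elim⟩
  have hexpand : ∑ z, P.real (Z ⁻¹' {z}) • ‖∑ i, centered r (z i) • v i‖ ^ 2
      = ∑ j, ∑ i, g i j * inner ℝ (v i) (v j) := by
    have e : ∀ z : Fin N → Bool, P.real (Z ⁻¹' {z}) • ‖∑ i, centered r (z i) • v i‖ ^ 2
        = ∑ j, ∑ i, P.real (Z ⁻¹' {z}) * (centered r (z i) * centered r (z j)) *
          inner ℝ (v i) (v j) := by
      intro z
      rw [← real_inner_self_eq_norm_sq, inner_sum, smul_eq_mul, Finset.mul_sum]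
      refine Finset.sum_congr rfl fun j _ => ?_
      rw [sum_inner, Finset.mul_sum]
      refine Finset.sum_congr rfl fun i _ => ?_
      rw [real_inner_smul_left, real_inner_smul_right]
      ring
    rw [Finset.sum_congr rfl fun z _ => e z, Finset.sum_comm]
    refine Finset.sum_congr rfl fun j _ => ?_
    rw [Finset.sum_comm]
    refine Finset.sum_congr rfl fun i _ => ?_
    rw [hg, Finset.sum_mul]
  rw [hexpand, Finset.mul_sum]
  refine Finset.sum_le_sum fun j _ => ?_
  obtain ⟨β, hβ1, hβ2⟩ := hβ j
  have e : ∑ i, g i j * inner ℝ (v i) (v j) = (g j j - β) * ‖v j‖ ^ 2 := by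
    have : ∀ i, g i j * inner ℝ (v i) (v j)
        = β * inner ℝ (v i) (v j) + if i = j then (g j j - β) * ‖v j‖ ^ 2 else 0 := by
      intro i
      split_ifs with hij
      · subst hij; rw [real_inner_self_eq_norm_sq]; ring
      · rw [hβ2 i hij, add_zero]
    rw [Finset.sum_congr rfl fun i _ => this i, Finset.sum_add_distrib, ← Finset.mul_sum,
      ← sum_inner, hv]
    simp
  rw [e]
  refine mul_le_mul_of_nonneg_right ?_ (sq_nonneg _)
  linarith [(abs_le.1 (hgle j j)).2, (abs_le.1 hβ1).1]

theorem measureReal_norm_sum_centered_ge_le {Ω E : Type*} [MeasurableSpace Ω] {P : Measure Ω}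
    [IsProbabilityMeasure P] [NormedAddCommGroup E] [InnerProductSpace ℝ E] {N n : ℕ}
    {Z : Ω → Fin N → Bool} (hZ : IsCRE P n Z) {r : ℝ} (h0 : 0 ≤ r) (h1 : r ≤ 1) {v : Fin N → E}
    (hv : ∑ i, v i = 0) {M : ℝ} (hM : 0 < M) :
    P.real {ω | M ≤ ‖∑ i, centered r (Z ω i) • v i‖} ≤ 2 * (∑ i, ‖v i‖ ^ 2) / M ^ 2 := by
  have hint : Integrable (fun ω => ‖∑ i, centered r (Z ω i) • v i‖ ^ 2) P := by
    have : IsProbabilityMeasure (P.map Z) :=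
      Measure.isProbabilityMeasure_map hZ.1.aemeasurable
    exact (Integrable.of_finite (μ := P.map Z)
      (f := fun z : Fin N → Bool => ‖∑ i, centered r (z i) • v i‖ ^ 2)).comp_measurable hZ.1
  have h := mul_meas_ge_le_integral_of_nonneg (Eventually.of_forall fun _ => sq_nonneg _) hint
    (M ^ 2)
  have h2 := integral_norm_sq_sum_centered_le hZ h0 h1 hv
  have hset : {ω | M ≤ ‖∑ i, centered r (Z ω i) • v i‖}
      = {ω | M ^ 2 ≤ ‖∑ i, centered r (Z ω i) • v i‖ ^ 2} := by
    ext ω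
    exact (pow_le_pow_iff_left₀ hM.le (norm_nonneg _) two_ne_zero).symm
  rw [hset, le_div_iff₀ (by positivity), mul_comm]
  exact h.trans h2

/-! ### Singular values and the sandwich matrix -/

section SingularValues

variable {p : ℕ} (A : Matrix (Fin p) (Fin p) ℝ)

theorem norm_sq_toEuclideanLin (v : Vec p) :
    ‖A.toEuclideanLin v‖ ^ 2 = ∑ i : Fin p, A.toEuclideanLin.singularValues i ^ 2 *
      inner ℝ (A.toEuclideanLin.isSymmetric_adjoint_comp_self.eigenvectorBasis
        finrank_euclideanSpace_fin i) v ^ 2 := by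
  set T := A.toEuclideanLin
  set u := T.isSymmetric_adjoint_comp_self.eigenvectorBasis finrank_euclideanSpace_fin
  rw [← real_inner_self_eq_norm_sq, ← LinearMap.adjoint_inner_left, ← LinearMap.comp_apply,
    ← u.sum_inner_mul_inner]
  refine Finset.sum_congr rfl fun i _ => ?_
  rw [T.sq_singularValues_fin finrank_euclideanSpace_fin i,
    T.isSymmetric_adjoint_comp_self v (u i),
    T.isSymmetric_adjoint_comp_self.apply_eigenvectorBasis finrank_euclideanSpace_fin i]
  simp only [RCLike.ofReal_real_eq_id, id]
  rw [real_inner_smul_right, real_inner_comm v (u i)]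
  ring

theorem norm_toEuclideanLin_le (v : Vec p) : ‖A.toEuclideanLin v‖ ≤ sigmaMax A * ‖v‖ := by
  have h0 := A.toEuclideanLin.singularValues_nonneg 0
  refine le_of_sq_le_sq ?_ (mul_nonneg h0 (norm_nonneg _))
  rw [norm_sq_toEuclideanLin, mul_pow,
    ← (A.toEuclideanLin.isSymmetric_adjoint_comp_self.eigenvectorBasis
    finrank_euclideanSpace_fin).sum_sq_inner_right v, Finset.mul_sum]
  refine Finset.sum_le_sum fun i _ => mul_le_mul_of_nonneg_right ?_ (sq_nonneg _)
  exact pow_le_pow_left₀ (A.toEuclideanLin.singularValues_nonneg _)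
    (A.toEuclideanLin.singularValues_antitone (Nat.zero_le _)) 2

theorem sigmaMin_mul_norm_le (v : Vec p) : sigmaMin A * ‖v‖ ≤ ‖A.toEuclideanLin v‖ := by
  refine le_of_sq_le_sq ?_ (norm_nonneg _)
  rw [norm_sq_toEuclideanLin, mul_pow,
    ← (A.toEuclideanLin.isSymmetric_adjoint_comp_self.eigenvectorBasis
    finrank_euclideanSpace_fin).sum_sq_inner_right v, Finset.mul_sum]
  refine Finset.sum_le_sum fun i _ => mul_le_mul_of_nonneg_right ?_ (sq_nonneg _)
  exact pow_le_pow_left₀ (A.toEuclideanLin.singularValues_nonneg _)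
    (A.toEuclideanLin.singularValues_antitone (by have := i.2; omega)) 2

variable {A} {c : ℝ}

theorem isUnit_det_of_le_sigmaMin (hc : 0 < c) (h : c ≤ sigmaMin A) : IsUnit A.det := by
  rw [← Matrix.isUnit_iff_isUnit_det, ← Matrix.mulVec_injective_iff_isUnit,
    ← Matrix.coe_mulVecLin, injective_iff_map_eq_zero]
  intro v hv
  have h1 := sigmaMin_mul_norm_le A (WithLp.toLp 2 v)
  have h2 : A.toEuclideanLin (WithLp.toLp 2 v) = 0 := by
    rw [Matrix.toLpLin_toLp]
    have : Matrix.toLin' A v = 0 := hv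
    rw [this]; rfl
  rw [h2, norm_zero] at h1
  have h3 : ‖WithLp.toLp 2 v‖ = 0 := by
    have := norm_nonneg (WithLp.toLp 2 v)
    nlinarith
  simpa using h3

theorem toEuclideanLin_mul_apply (A B : Matrix (Fin p) (Fin p) ℝ) (v : Vec p) :
    (A * B).toEuclideanLin v = A.toEuclideanLin (B.toEuclideanLin v) := by
  simp [Matrix.toLpLin_apply, Matrix.mulVec_mulVec]

theorem toEuclideanLin_inv_apply (h : IsUnit A.det) (v : Vec p) :
    A⁻¹.toEuclideanLin (A.toEuclideanLin v) = v := by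
  rw [← toEuclideanLin_mul_apply, Matrix.nonsing_inv_mul _ h]
  simp

theorem toEuclideanLin_apply_inv (h : IsUnit A.det) (v : Vec p) :
    A.toEuclideanLin (A⁻¹.toEuclideanLin v) = v := by
  rw [← toEuclideanLin_mul_apply, Matrix.mul_nonsing_inv _ h]
  simp

theorem inner_toEuclideanLin_left (A : Matrix (Fin p) (Fin p) ℝ) (v w : Vec p) :
    inner ℝ (A.toEuclideanLin v) w = inner ℝ v (A.transpose.toEuclideanLin w) := by
  rw [← Matrix.conjTranspose_eq_transpose_of_trivial,
    Matrix.toEuclideanLin_conjTranspose_eq_adjoint,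
    LinearMap.adjoint_inner_right]

theorem norm_toEuclideanLin_inv_le (hc : 0 < c) (h : c ≤ sigmaMin A) (v : Vec p) :
    ‖A⁻¹.toEuclideanLin v‖ ≤ c⁻¹ * ‖v‖ := by
  have h1 := sigmaMin_mul_norm_le A (A⁻¹.toEuclideanLin v)
  rw [toEuclideanLin_apply_inv (isUnit_det_of_le_sigmaMin hc h)] at h1
  rw [inv_mul_eq_div, le_div_iff₀ hc, mul_comm]
  exact (mul_le_mul_of_nonneg_right h (norm_nonneg _)).trans h1

theorem norm_toEuclideanLin_transpose_inv_le (hc : 0 < c) (h : c ≤ sigmaMin A) (v : Vec p) :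
    ‖A.transpose⁻¹.toEuclideanLin v‖ ≤ c⁻¹ * ‖v‖ := by
  set w := A.transpose⁻¹.toEuclideanLin v with hw
  have h1 : ‖w‖ * ‖w‖ = inner ℝ (A⁻¹.toEuclideanLin w) v := by
    rw [inner_toEuclideanLin_left, Matrix.transpose_nonsing_inv, ← hw,
      real_inner_self_eq_norm_mul_norm]
  have h2 : ‖w‖ * ‖w‖ ≤ (c⁻¹ * ‖v‖) * ‖w‖ := by
    rw [h1]
    refine (real_inner_le_norm _ _).trans ?_
    have := mul_le_mul_of_nonneg_right (norm_toEuclideanLin_inv_le hc h w) (norm_nonneg v)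
    linarith
  rcases (norm_nonneg w).eq_or_lt with h0 | h0
  · rw [← h0]; positivity
  · exact le_of_mul_le_mul_right h2 h0

end SingularValues

section Covariance

variable {N p : ℕ}

theorem sum_sub_avg {V : Type*} [AddCommGroup V] [Module ℝ V] (c : Fin N → V) :
    ∑ j, (c j - avg c) = 0 := by
  rcases Nat.eq_zero_or_pos N with rfl | hN
  · simp
  · have : (N : ℝ) ≠ 0 := by positivity
    rw [Finset.sum_sub_distrib, Finset.sum_const, Finset.card_univ, Fintype.card_fin, avg,
      ← Nat.cast_smul_eq_nsmul ℝ, smul_smul, mul_inv_cancel₀ this, one_smul, sub_self]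

theorem avg_sub {V : Type*} [AddCommGroup V] [Module ℝ V] (c d : Fin N → V) :
    avg (fun i => c i - d i) = avg c - avg d := by
  simp [avg, Finset.sum_sub_distrib, smul_sub]

theorem inner_toEuclideanLin_cov (c : Fin N → Vec p) (s t : Vec p) :
    inner ℝ s ((cov c).toEuclideanLin t)
      = ((N : ℝ) - 1)⁻¹ * ∑ j, inner ℝ s (c j - avg c) * inner ℝ t (c j - avg c) := by
  have h : ∀ (s x : Vec p), inner ℝ s x = ∑ a, s a * x a := fun s x => by
    simp [PiLp.inner_apply, mul_comm]
  rw [h]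
  have h2 : ∀ a, ((cov c).toEuclideanLin t) a = ((N : ℝ) - 1)⁻¹ *
      ∑ j, (c j - avg c) a * inner ℝ t (c j - avg c) := by
    intro a
    simp only [Matrix.ofLp_toLpLin, Matrix.toLin'_apply, Matrix.mulVec, dotProduct, cov,
      Matrix.of_apply, h]
    simp only [Finset.mul_sum, Finset.sum_mul]
    rw [Finset.sum_comm]
    exact Finset.sum_congr rfl fun j _ => Finset.sum_congr rfl fun b _ => by ring
  simp only [h2, Finset.mul_sum]
  rw [Finset.sum_comm]
  refine Finset.sum_congr rfl fun j _ => ?_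
  rw [h s, Finset.sum_mul, Finset.mul_sum]
  exact Finset.sum_congr rfl fun a _ => by ring

theorem posSemidef_cov (hN : 1 ≤ N) (c : Fin N → Vec p) : (cov c).PosSemidef := by
  refine Matrix.PosSemidef.of_dotProduct_mulVec_nonneg ?_ fun x => ?_
  · ext a b
    simp [cov, mul_comm]
  · have h := inner_toEuclideanLin_cov c (WithLp.toLp 2 x) (WithLp.toLp 2 x)
    have e : star x ⬝ᵥ (cov c).mulVec x
        = inner ℝ (WithLp.toLp 2 x) ((cov c).toEuclideanLin (WithLp.toLp 2 x)) := by
      simp [PiLp.inner_apply, dotProduct, mul_comm]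
    rw [e, h]
    have h1 : (1 : ℝ) ≤ N := by exact_mod_cast hN
    exact mul_nonneg (inv_nonneg.2 (by linarith))
      (Finset.sum_nonneg fun j _ => mul_self_nonneg _)

/-- The total variance is the trace of the covariance matrix. -/
theorem sum_norm_sq_sub_avg_le (hN : 2 ≤ N) (c : Fin N → Vec p) {K : ℝ}
    (hK : sigmaMax (cov c) ≤ K) : ∑ j, ‖c j - avg c‖ ^ 2 ≤ N * (p * K) := by
  have h2 : (2 : ℝ) ≤ N := by exact_mod_cast hN
  have hK0 : 0 ≤ K := le_trans ((cov c).toEuclideanLin.singularValues_nonneg 0) hK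
  have hcoord : ∀ a : Fin p, ((N : ℝ) - 1)⁻¹ * ∑ j, ((c j - avg c) a) ^ 2 ≤ K := by
    intro a
    have h := inner_toEuclideanLin_cov c (EuclideanSpace.single a (1 : ℝ))
      (EuclideanSpace.single a (1 : ℝ))
    have e : ∀ j, inner ℝ (EuclideanSpace.single a (1 : ℝ)) (c j - avg c)
      * inner ℝ (EuclideanSpace.single a (1 : ℝ)) (c j - avg c) = ((c j - avg c) a) ^ 2 := by
      intro j
      rw [EuclideanSpace.inner_single_left]; simp; ring
    simp only [e] at h
    rw [← h]
    refine (real_inner_le_norm _ _).trans ?_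
    have := norm_toEuclideanLin_le (cov c) (EuclideanSpace.single a (1 : ℝ))
    simp only [PiLp.norm_single, norm_one, mul_one, one_mul] at this ⊢
    exact this.trans hK
  have hsum : ∑ j, ‖c j - avg c‖ ^ 2 = ∑ a : Fin p, ∑ j, ((c j - avg c) a) ^ 2 := by
    rw [Finset.sum_comm]
    exact Finset.sum_congr rfl fun j _ => EuclideanSpace.real_norm_sq_eq _
  rw [hsum]
  calc _ ≤ ∑ _a : Fin p, ((N : ℝ) * K) := by
        refine Finset.sum_le_sum fun a _ => ?_
        have := hcoord a
        rw [inv_mul_le_iff₀ (by linarith)] at this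
        nlinarith
    _ = _ := by simp; ring

theorem posSemidef_sandwich {𝒳 𝒴 : Type*} (Θ : Set (Vec p)) (ψ : Bool → 𝒴 → 𝒳 → Vec p → Vec p)
    (e : Population 𝒳 𝒴 N) (θ : Vec p) (hN : 1 ≤ N) (h1 : 0 ≤ e.r true) (h0 : 0 ≤ e.r false) :
    (sandwich Θ ψ e θ).PosSemidef := by
  refine Matrix.PosSemidef.smul ?_ (mul_nonneg h1 h0)
  have := (posSemidef_cov hN (fun i => unitPsi ψ e true i θ -
    unitPsi ψ e false i θ)).mul_mul_conjTranspose_same (jacobian Θ (popPsi ψ e) θ)⁻¹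
  rwa [Matrix.conjTranspose_eq_transpose_of_trivial, Matrix.transpose_nonsing_inv] at this

theorem dotProduct_sandwich_mulVec {𝒳 𝒴 : Type*} (Θ : Set (Vec p))
    (ψ : Bool → 𝒴 → 𝒳 → Vec p → Vec p) (e : Population 𝒳 𝒴 N) (θ : Vec p) (s t : Vec p) :
    let d := fun i => unitPsi ψ e true i θ - unitPsi ψ e false i θ
    let K := ((jacobian Θ (popPsi ψ e) θ).transpose)⁻¹.toEuclideanLin
    s.ofLp ⬝ᵥ (sandwich Θ ψ e θ).mulVec t.ofLp = e.r true * e.r false *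
      (((N : ℝ) - 1)⁻¹ * ∑ j, inner ℝ (K s) (d j - avg d) * inner ℝ (K t) (d j - avg d)) := by
  intro d K
  rw [← inner_toEuclideanLin_cov d]
  have e1 : s.ofLp ⬝ᵥ (sandwich Θ ψ e θ).mulVec t.ofLp
      = inner ℝ ((sandwich Θ ψ e θ).toEuclideanLin t) s := by
    simp [PiLp.inner_apply, dotProduct]
  rw [e1, sandwich, map_smul, LinearMap.smul_apply, toEuclideanLin_mul_apply,
    toEuclideanLin_mul_apply, real_inner_smul_left, inner_toEuclideanLin_left,
    Matrix.transpose_nonsing_inv, real_inner_comm]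

end Covariance

/-! ### The estimating function at the population root -/

section Effects

variable {𝒳 𝒴 : Type*} {N p : ℕ} (ψ : Bool → 𝒴 → 𝒳 → Vec p → Vec p) (e : Population 𝒳 𝒴 N)
  (θ : Vec p)

/-- The unit-level difference `ψ_{1i}(θ) - ψ_{0i}(θ)`, centred at its population average and divided
by `√N`. -/
noncomputable def scaledEffect (i : Fin N) : Vec p :=
  (√(N : ℝ))⁻¹ • (unitPsi ψ e true i θ - unitPsi ψ e false i θ -
    avg fun i => unitPsi ψ e true i θ - unitPsi ψ e false i θ)

theorem sum_scaledEffect : ∑ i, scaledEffect ψ e θ i = 0 := by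
  simp only [scaledEffect]
  rw [← Finset.smul_sum, sum_sub_avg (fun i => unitPsi ψ e true i θ - unitPsi ψ e false i θ),
    smul_zero]

theorem scaledEffect_eq (i : Fin N) : scaledEffect ψ e θ i =
    (√(N : ℝ))⁻¹ • (unitPsi ψ e true i θ - avg fun i => unitPsi ψ e true i θ) -
    (√(N : ℝ))⁻¹ • (unitPsi ψ e false i θ - avg fun i => unitPsi ψ e false i θ) := by
  rw [scaledEffect, avg_sub, ← smul_sub]
  congr 1
  abel

theorem sum_norm_sq_scaledEffect_le (hN : 2 ≤ N) {K : Bool → ℝ}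
    (hK : ∀ z, sigmaMax (cov fun i => unitPsi ψ e z i θ) ≤ K z) :
    ∑ i, ‖scaledEffect ψ e θ i‖ ^ 2 ≤ 2 * p * (K true + K false) := by
  have hNpos : (0 : ℝ) < N := by exact_mod_cast (by omega : 0 < N)
  have h : ∀ i, ‖scaledEffect ψ e θ i‖ ^ 2 ≤ 2 * ((N : ℝ)⁻¹ *
      ‖unitPsi ψ e true i θ - avg fun i => unitPsi ψ e true i θ‖ ^ 2) + 2 * ((N : ℝ)⁻¹ *
      ‖unitPsi ψ e false i θ - avg fun i => unitPsi ψ e false i θ‖ ^ 2) := by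
    intro i
    have hn : ∀ v : Vec p, ‖(√(N : ℝ))⁻¹ • v‖ ^ 2 = (N : ℝ)⁻¹ * ‖v‖ ^ 2 := by
      intro v
      rw [norm_smul, mul_pow, norm_inv, Real.norm_of_nonneg (Real.sqrt_nonneg _), inv_pow,
        Real.sq_sqrt hNpos.le]
    rw [scaledEffect_eq, ← hn, ← hn]
    have := norm_sub_le ((√(N : ℝ))⁻¹ • (unitPsi ψ e true i θ - avg fun i => unitPsi ψ e true i θ))
      ((√(N : ℝ))⁻¹ • (unitPsi ψ e false i θ - avg fun i => unitPsi ψ e false i θ))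
    refine (pow_le_pow_left₀ (norm_nonneg _) this 2).trans ?_
    refine (add_sq_le).trans ?_
    linarith
  refine (Finset.sum_le_sum fun i _ => h i).trans ?_
  rw [Finset.sum_add_distrib, ← Finset.mul_sum, ← Finset.mul_sum, ← Finset.mul_sum,
    ← Finset.mul_sum]
  have ht := sum_norm_sq_sub_avg_le hN _ (hK true)
  have hf := sum_norm_sq_sub_avg_le hN _ (hK false)
  have ht' := (inv_mul_le_iff₀ hNpos).2 ht
  have hf' := (inv_mul_le_iff₀ hNpos).2 hf
  linarith

theorem norm_scaledEffect_le (i : Fin N) : ‖scaledEffect ψ e θ i‖ ≤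
    √((N : ℝ)⁻¹ * ⨆ j : Fin N, ‖unitPsi ψ e true j θ - avg (fun i => unitPsi ψ e true i θ)‖ ^ 2) +
    √((N : ℝ)⁻¹ * ⨆ j : Fin N,
      ‖unitPsi ψ e false j θ - avg (fun i => unitPsi ψ e false i θ)‖ ^ 2) := by
  have h : ∀ f : Fin N → Vec p, ‖(√(N : ℝ))⁻¹ • f i‖ ≤ √((N : ℝ)⁻¹ * ⨆ j, ‖f j‖ ^ 2) := by
    intro f
    refine Real.le_sqrt_of_sq_le ?_
    rw [norm_smul, mul_pow, norm_inv, Real.norm_of_nonneg (Real.sqrt_nonneg _), inv_pow,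
      Real.sq_sqrt (Nat.cast_nonneg _)]
    exact mul_le_mul_of_nonneg_left
      (le_ciSup (f := fun j => ‖f j‖ ^ 2) (Set.finite_range _).bddAbove i) (by positivity)
  rw [scaledEffect_eq]
  exact (norm_sub_le _ _).trans (add_le_add
    (h fun i => unitPsi ψ e true i θ - avg fun i => unitPsi ψ e true i θ)
    (h fun i => unitPsi ψ e false i θ - avg fun i => unitPsi ψ e false i θ))

variable {e} in
theorem Population.r_false (hN : 0 < N) : e.r false = 1 - e.r true := by
  have : (N : ℝ) ≠ 0 := by positivity
  simp [Population.r]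
  field_simp

variable {ψ e θ} in
/-- At the population root the empirical estimating function is a linear statistic of the
assignment. -/
theorem sqrt_smul_empPsi (hN : 0 < N) (hroot : popPsi ψ e θ = 0) {z : Fin N → Bool}
    (hz : numTreated z = e.treated) :
    √(N : ℝ) • empPsi ψ e z θ = ∑ i, centered (e.r true) (z i) • scaledEffect ψ e θ i := by
  have hNpos : (0 : ℝ) < N := by exact_mod_cast hN
  have h1 : empPsi ψ e z θ - popPsi ψ e θ = (N : ℝ)⁻¹ • ∑ i, centered (e.r true) (z i) •
      (unitPsi ψ e true i θ - unitPsi ψ e false i θ) := by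
    have hterm : ∀ i, centered (e.r true) (z i) • (unitPsi ψ e true i θ - unitPsi ψ e false i θ)
        = ψ (z i) (e.Y (z i) i) (e.X i) θ -
          (e.r true • unitPsi ψ e true i θ + (1 - e.r true) • unitPsi ψ e false i θ) := by
      intro i
      cases h : z i <;> simp [centered, unitPsi] <;> module
    simp only [hterm, empPsi, popPsi, avg, Population.r_false hN]
    rw [Finset.sum_sub_distrib, Finset.sum_add_distrib, ← Finset.smul_sum, ← Finset.smul_sum]
    module
  have h2 : ∑ i, centered (e.r true) (z i) = 0 := by
    rw [sum_centered, hz, Population.r]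
    simp
    field_simp
    simp
  rw [hroot, sub_zero] at h1
  rw [h1, smul_smul]
  simp only [scaledEffect]
  have h3 : ∀ i, centered (e.r true) (z i) • (√(N : ℝ))⁻¹ • (unitPsi ψ e true i θ -
      unitPsi ψ e false i θ - avg fun i => unitPsi ψ e true i θ - unitPsi ψ e false i θ)
      = (√(N : ℝ))⁻¹ • (centered (e.r true) (z i) •
        (unitPsi ψ e true i θ - unitPsi ψ e false i θ) - centered (e.r true) (z i) •
        avg fun i => unitPsi ψ e true i θ - unitPsi ψ e false i θ) := fun i => by module
  rw [Finset.sum_congr rfl fun i _ => h3 i, ← Finset.smul_sum, Finset.sum_sub_distrib,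
    ← Finset.sum_smul, h2, zero_smul, sub_zero]
  congr 1
  rw [← div_eq_mul_inv, Real.sqrt_div_self]

theorem dotProduct_sandwich_mulVec_eq_scaledEffect (hN : 0 < N) (Θ : Set (Vec p)) (s t : Vec p) :
    s.ofLp ⬝ᵥ (sandwich Θ ψ e θ).mulVec t.ofLp = e.r true * e.r false * ((N : ℝ) / (N - 1)) *
      ∑ j, inner ℝ (((jacobian Θ (popPsi ψ e) θ).transpose)⁻¹.toEuclideanLin s)
          (scaledEffect ψ e θ j) *
        inner ℝ (((jacobian Θ (popPsi ψ e) θ).transpose)⁻¹.toEuclideanLin t)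
          (scaledEffect ψ e θ j) := by
  have hNpos : (0 : ℝ) < N := by exact_mod_cast hN
  rw [dotProduct_sandwich_mulVec]
  simp only [scaledEffect, real_inner_smul_right]
  have h : ∀ a b : ℝ, (√(N : ℝ))⁻¹ * a * ((√(N : ℝ))⁻¹ * b) = (N : ℝ)⁻¹ * (a * b) := by
    intro a b
    have : (√(N : ℝ))⁻¹ * (√(N : ℝ))⁻¹ = (N : ℝ)⁻¹ := by
      rw [← mul_inv, Real.mul_self_sqrt hNpos.le]
    rw [← this]; ring
  simp only [h, ← Finset.mul_sum]
  field_simp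

end Effects

/-! ### Linearization of the empirical estimating function -/

section Linearization

variable {𝒳 𝒴 : Type*} {N p : ℕ} {Θ : Set (Vec p)} {ψ : Bool → 𝒴 → 𝒳 → Vec p → Vec p}
  {e : Population 𝒳 𝒴 N}

theorem toEuclideanLin_jacobian (f : Vec p → Vec p) (θ v : Vec p) :
    (jacobian Θ f θ).toEuclideanLin v = fderivWithin ℝ f Θ θ v := by
  have h : (jacobian Θ f θ).toEuclideanLin = (fderivWithin ℝ f Θ θ : Vec p →ₗ[ℝ] Vec p) := by
    refine (EuclideanSpace.basisFun (Fin p) ℝ).toBasis.ext fun b => ?_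
    ext a
    simp [jacobian]
  rw [h]; rfl

theorem hasFDerivAt_empPsi (hψ : ∀ z y x, ContDiffOn ℝ 1 (ψ z y x) Θ) (Z : Fin N → Bool)
    {θ : Vec p} (hθ : Θ ∈ 𝓝 θ) :
    HasFDerivAt (empPsi ψ e Z) (fderivWithin ℝ (empPsi ψ e Z) Θ θ) θ := by
  have hd : DifferentiableAt ℝ (empPsi ψ e Z) θ := by
    refine DifferentiableAt.fun_const_smul (f := fun θ => ∑ i, ψ (Z i) (e.Y (Z i) i) (e.X i) θ)
      ?_ _
    refine DifferentiableAt.fun_sum fun i _ => ?_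
    exact ((hψ _ _ _).differentiableOn one_ne_zero).differentiableAt hθ
  rw [fderivWithin_of_mem_nhds hθ]
  exact hd.hasFDerivAt

theorem fderivWithin_popPsi (hψ : ∀ z y x, ContDiffOn ℝ 1 (ψ z y x) Θ)
    {θ : Vec p} (hθ : Θ ∈ 𝓝 θ) :
    fderivWithin ℝ (popPsi ψ e) Θ θ =
      e.r true • avg (fun i => fderivWithin ℝ (unitPsi ψ e true i) Θ θ) +
      e.r false • avg (fun i => fderivWithin ℝ (unitPsi ψ e false i) Θ θ) := by
  rw [fderivWithin_of_mem_nhds hθ]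
  have hd : ∀ z i, HasFDerivAt (fun θ => unitPsi ψ e z i θ)
      (fderivWithin ℝ (unitPsi ψ e z i) Θ θ) θ := by
    intro z i
    rw [fderivWithin_of_mem_nhds hθ]
    exact (((hψ z _ _).differentiableOn one_ne_zero).differentiableAt hθ).hasFDerivAt
  have ha : ∀ z, HasFDerivAt (fun θ => avg (fun i => unitPsi ψ e z i θ))
      (avg fun i => fderivWithin ℝ (unitPsi ψ e z i) Θ θ) θ := fun z =>
    (HasFDerivAt.fun_sum (u := Finset.univ) fun i _ => hd z i).fun_const_smul (N : ℝ)⁻¹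
  exact (((ha true).const_smul (e.r true)).add ((ha false).const_smul (e.r false))).fderiv

theorem norm_avg_sub_avg_le_of_osc_le {F : Type*} [NormedAddCommGroup F] [NormedSpace ℝ F]
    {f : Fin N → Vec p → F} (hN : 0 < N) {θ₀ θ : Vec p} {δ η : ℝ} (hη : 0 ≤ η) (hθ : θ ∈ Θ)
    (hδ : ‖θ - θ₀‖ ≤ δ) (h : (∑ i, osc Θ (f i) θ₀ δ) / (N : ℝ≥0∞) ≤ ENNReal.ofReal η) :
    ‖avg (fun i => f i θ) - avg (fun i => f i θ₀)‖ ≤ η := by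
  have h1 : ∑ i, ‖f i θ - f i θ₀‖ₑ ≤ ∑ i, osc Θ (f i) θ₀ δ :=
    Finset.sum_le_sum fun i _ =>
      le_iSup₂ (f := fun θ (_ : θ ∈ {θ | θ ∈ Θ ∧ ‖θ - θ₀‖ ≤ δ}) => ‖f i θ - f i θ₀‖ₑ) θ ⟨hθ, hδ⟩
  have h2 : ENNReal.ofReal (‖avg (fun i => f i θ) - avg (fun i => f i θ₀)‖)
      ≤ ENNReal.ofReal η := by
    refine le_trans ?_ h
    rw [ofReal_norm, ← avg_sub, avg, enorm_smul, ENNReal.div_eq_inv_mul]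
    gcongr
    · rw [enorm_inv (by positivity)]
      simp
    · exact (enorm_sum_le _ _).trans h1
  exact (ENNReal.ofReal_le_ofReal_iff hη).1 h2

/-- The mean value inequality for the empirical estimating function, whose derivative near `θ₀` is
close to that of the population estimating function, which in turn is nearly constant. -/
theorem norm_empPsi_sub_sub_le (hψ : ∀ z y x, ContDiffOn ℝ 1 (ψ z y x) Θ) (hN : 0 < N)
    (hr1 : 0 ≤ e.r true) (hr0 : 0 ≤ e.r false) {Z : Fin N → Bool} {θ₀ : Vec p} {ε δ ρ η : ℝ}
    (hball : Metric.ball θ₀ ε ⊆ Θ) (hδ0 : 0 ≤ δ) (hδε : δ < ε) (hδρ : δ ≤ ρ) (hη : 0 ≤ η)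
    (hosc : ∀ z, (∑ i, osc Θ (fderivWithin ℝ (unitPsi ψ e z i) Θ) θ₀ δ) / (N : ℝ≥0∞)
      ≤ ENNReal.ofReal η)
    (hunif : ⨆ ϑ ∈ {ϑ | ϑ ∈ Θ ∧ ‖ϑ - θ₀‖ ≤ ρ},
      ‖fderivWithin ℝ (empPsi ψ e Z) Θ ϑ - fderivWithin ℝ (popPsi ψ e) Θ ϑ‖ₑ ≤ ENNReal.ofReal η)
    {θ : Vec p} (hθ : ‖θ - θ₀‖ ≤ δ) :
    ‖empPsi ψ e Z θ - empPsi ψ e Z θ₀ -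
      (jacobian Θ (popPsi ψ e) θ₀).toEuclideanLin (θ - θ₀)‖ ≤ 2 * η * ‖θ - θ₀‖ := by
  rw [toEuclideanLin_jacobian]
  have hnhds : ∀ ϑ ∈ Metric.closedBall θ₀ δ, Θ ∈ 𝓝 ϑ := fun ϑ hϑ =>
    mem_of_superset (Metric.isOpen_ball.mem_nhds (Metric.closedBall_subset_ball hδε hϑ)) hball
  have h0 : θ₀ ∈ Metric.closedBall θ₀ δ := Metric.mem_closedBall_self hδ0
  refine Convex.norm_image_sub_le_of_norm_hasFDerivWithin_le' (s := Metric.closedBall θ₀ δ)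
    (f' := fun ϑ => fderivWithin ℝ (empPsi ψ e Z) Θ ϑ) ?_ ?_ (convex_closedBall _ _) h0
    (mem_closedBall_iff_norm.2 hθ)
  · exact fun ϑ hϑ => (hasFDerivAt_empPsi hψ Z (hnhds ϑ hϑ)).hasFDerivWithinAt
  · intro ϑ hϑ
    have hmem : ϑ ∈ Θ := mem_of_mem_nhds (hnhds ϑ hϑ)
    have hd : ‖ϑ - θ₀‖ ≤ δ := mem_closedBall_iff_norm.1 hϑ
    have h1 : ‖fderivWithin ℝ (empPsi ψ e Z) Θ ϑ - fderivWithin ℝ (popPsi ψ e) Θ ϑ‖ ≤ η := by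
      rw [← ENNReal.ofReal_le_ofReal_iff hη, ofReal_norm]
      exact (le_iSup₂ (f := fun ϑ (_ : ϑ ∈ {ϑ | ϑ ∈ Θ ∧ ‖ϑ - θ₀‖ ≤ ρ}) =>
        ‖fderivWithin ℝ (empPsi ψ e Z) Θ ϑ - fderivWithin ℝ (popPsi ψ e) Θ ϑ‖ₑ) ϑ
        ⟨hmem, hd.trans hδρ⟩).trans hunif
    have h2 : ‖fderivWithin ℝ (popPsi ψ e) Θ ϑ - fderivWithin ℝ (popPsi ψ e) Θ θ₀‖ ≤ η := by
      have ht := norm_avg_sub_avg_le_of_osc_le hN hη hmem hd (hosc true)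
      have hf := norm_avg_sub_avg_le_of_osc_le hN hη hmem hd (hosc false)
      have hconv : ∀ A B C D : Vec p →L[ℝ] Vec p, ‖A - B‖ ≤ η → ‖C - D‖ ≤ η →
          ‖e.r true • A + e.r false • C - (e.r true • B + e.r false • D)‖ ≤ η := by
        intro A B C D hAB hCD
        have hAC : e.r true • A + e.r false • C - (e.r true • B + e.r false • D)
            = e.r true • (A - B) + e.r false • (C - D) := by module
        rw [hAC]
        refine (norm_add_le _ _).trans ?_
        rw [norm_smul, norm_smul, Real.norm_of_nonneg hr1, Real.norm_of_nonneg hr0]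
        have := Population.r_false (e := e) hN
        nlinarith [mul_le_mul_of_nonneg_left hAB hr1, mul_le_mul_of_nonneg_left hCD hr0]
      rw [fderivWithin_popPsi hψ (hnhds ϑ hϑ), fderivWithin_popPsi hψ (hnhds θ₀ h0)]
      exact hconv _ _ _ _ ht hf
    have e3 : fderivWithin ℝ (empPsi ψ e Z) Θ ϑ - fderivWithin ℝ (popPsi ψ e) Θ θ₀
        = (fderivWithin ℝ (empPsi ψ e Z) Θ ϑ - fderivWithin ℝ (popPsi ψ e) Θ ϑ) +
          (fderivWithin ℝ (popPsi ψ e) Θ ϑ - fderivWithin ℝ (popPsi ψ e) Θ θ₀) := by abel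
    rw [e3]
    exact (norm_add_le _ _).trans (by linarith)

end Linearization

/-! ### Asymptotic normality -/

theorem IsCRE.ae_numTreated_eq {Ω : Type*} [MeasurableSpace Ω] {P : Measure Ω} {N n : ℕ}
    {Z : Ω → Fin N → Bool} (h : IsCRE P n Z) : ∀ᵐ ω ∂P, numTreated (Z ω) = n := by
  have h1 : ∀ z : Fin N → Bool, ∀ᵐ ω ∂P, numTreated z ≠ n → Z ω ≠ z := by
    intro z
    by_cases hz : numTreated z = n
    · exact Eventually.of_forall fun _ h => (h hz).elim
    · have h0 : P (Z ⁻¹' {z}) = 0 := by rw [h.2, if_neg hz]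
      refine (measure_eq_zero_iff_ae_notMem.1 h0).mono fun ω hω _ heq => hω heq
  filter_upwards [ae_all_iff.2 h1] with ω hω
  by_contra hne
  exact hω _ hne rfl

theorem abs_exp_neg_sub_exp_neg_le {x y : ℝ} (hx : 0 ≤ x) (hxy : x ≤ y) :
    |Real.exp (-x) - Real.exp (-y)| ≤ y - x := by
  have h1 : Real.exp (-y) = Real.exp (-x) * Real.exp (-(y - x)) := by
    rw [← Real.exp_add]; ring_nf
  have h2 := Real.add_one_le_exp (-(y - x))
  have h3 : Real.exp (-x) ≤ 1 := Real.exp_le_one_iff.2 (by linarith)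
  have h4 : Real.exp (-y) ≤ Real.exp (-x) := Real.exp_le_exp.2 (by linarith)
  rw [abs_of_nonneg (by linarith), h1]
  nlinarith [Real.exp_pos (-x)]

section Normality

variable {𝒳 𝒴 : Type*} {p : ℕ} {N₀ : ℕ} {Θ : Set (Vec p)} {ψ : Bool → 𝒴 → 𝒳 → Vec p → Vec p}
  {e : ∀ N, Population 𝒳 𝒴 N} {θ : ℕ → Vec p} {Ω : ℕ → Type*} [∀ N, MeasurableSpace (Ω N)]
  {P : ∀ N, Measure (Ω N)} [∀ N, IsProbabilityMeasure (P N)] {Z : ∀ N, Ω N → Fin N → Bool}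

/-- The linear approximation `-Ψ̇_N(θ_N)⁻¹ √N Ψ̂_N(θ_N)` of the rescaled estimation error as a
function of the assignment. -/
noncomputable def linearApprox {N : ℕ} (Θ : Set (Vec p)) (ψ : Bool → 𝒴 → 𝒳 → Vec p → Vec p)
    (e : Population 𝒳 𝒴 N) (θ : Vec p) (z : Fin N → Bool) : Vec p :=
  -(jacobian Θ (popPsi ψ e) θ)⁻¹.toEuclideanLin (√(N : ℝ) • empPsi ψ e z θ)

theorem exists_sum_norm_sq_scaledEffect_le (h3 : Boundedness N₀ Θ ψ e θ) :
    ∃ Q, 0 ≤ Q ∧ ∀ᶠ N in atTop, ∑ i, ‖scaledEffect ψ (e N) (θ N) i‖ ^ 2 ≤ Q := by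
  choose c₀ hc₀ hc using h3.2.1
  refine ⟨2 * p * (c₀ true + c₀ false), ?_, ?_⟩
  · have := hc₀ true
    have := hc₀ false
    positivity
  · filter_upwards [eventually_ge_atTop N₀, eventually_ge_atTop 2] with N hN hN2
    exact sum_norm_sq_scaledEffect_le ψ (e N) (θ N) hN2 fun z => hc z N hN

/-- The law of the linear approximation is asymptotically Gaussian with the sandwich covariance:
its characteristic function at `t` is that of a linear statistic of the assignment. -/
theorem tendsto_charFun_linearApprox_sub (hZ : ∀ N, N₀ ≤ N → IsCRE (P N) (e N).treated (Z N))
    (h1 : InteriorRoot N₀ Θ ψ e θ) (h3 : Boundedness N₀ Θ ψ e θ) (t : Vec p) :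
    Tendsto (fun N => charFun ((P N).map fun ω => linearApprox Θ ψ (e N) (θ N) (Z N ω)) t
      - Complex.exp (-(t.ofLp ⬝ᵥ (sandwich Θ ψ (e N) (θ N)).mulVec t.ofLp : ℝ) / 2)) atTop
      (𝓝 0) := by
  obtain ⟨Q, hQ0, hQ⟩ := exists_sum_norm_sq_scaledEffect_le h3
  obtain ⟨⟨c, hc, hr⟩, -, ⟨c₁, c₂, hc₁, -, hσ⟩, hmax⟩ := h3
  set b : ∀ N, Fin N → ℝ := fun N j => -inner ℝ (scaledEffect ψ (e N) (θ N) j)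
    ((jacobian Θ (popPsi ψ (e N)) (θ N)).transpose⁻¹.toEuclideanLin t) with hb
  set m : ℕ → ℝ := fun N =>
    √((N : ℝ)⁻¹ * ⨆ j : Fin N, ‖unitPsi ψ (e N) true j (θ N) -
      avg (fun i => unitPsi ψ (e N) true i (θ N))‖ ^ 2) +
    √((N : ℝ)⁻¹ * ⨆ j : Fin N, ‖unitPsi ψ (e N) false j (θ N) -
      avg (fun i => unitPsi ψ (e N) false i (θ N))‖ ^ 2) with hm
  have hm0 : Tendsto m atTop (𝓝 0) := by
    have := (hmax true).sqrt.add (hmax false).sqrt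
    rwa [Real.sqrt_zero, add_zero] at this
  have hbnorm : ∀ᶠ N in atTop, ∀ j,
      |b N j| ≤ ‖scaledEffect ψ (e N) (θ N) j‖ * (c₁⁻¹ * ‖t‖) := by
    filter_upwards [eventually_ge_atTop N₀] with N hN j
    rw [hb, abs_neg]
    refine (abs_real_inner_le_norm _ _).trans ?_
    gcongr
    exact norm_toEuclideanLin_transpose_inv_le hc₁ (hσ N hN).1 t
  have hB : ∀ᶠ N in atTop, ∑ j, b N j ^ 2 ≤ Q * (c₁⁻¹ * ‖t‖) ^ 2 := by
    filter_upwards [hbnorm, hQ] with N hN hQN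
    calc _ ≤ ∑ j, ‖scaledEffect ψ (e N) (θ N) j‖ ^ 2 * (c₁⁻¹ * ‖t‖) ^ 2 := by
          refine Finset.sum_le_sum fun j _ => ?_
          rw [← sq_abs, ← mul_pow]
          exact pow_le_pow_left₀ (abs_nonneg _) (hN j) 2
      _ ≤ _ := by
          rw [← Finset.sum_mul]
          gcongr
  have hr0 : ∀ᶠ N in atTop, c ≤ (e N).r true := by
    filter_upwards [eventually_ge_atTop N₀] with N hN using (hr N hN true).1
  have hr1 : ∀ᶠ N in atTop, (e N).r true ≤ 1 - c := by
    filter_upwards [eventually_ge_atTop N₀] with N hN using (hr N hN true).2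
  have hclt := tendsto_integral_exp_sum_centered_sub (P := P) (Z := Z) (n := fun N => (e N).treated)
    hc (r := fun N => (e N).r true) (b := b) (M := fun N => m N * (c₁⁻¹ * ‖t‖))
    (by filter_upwards [eventually_ge_atTop N₀] with N hN using hZ N hN)
    (by
      filter_upwards [eventually_gt_atTop 0] with N hN
      have : (N : ℝ) ≠ 0 := by positivity
      simp [Population.r]
      field_simp)
    hr0 hr1
    (Eventually.of_forall fun N => by
      simp only [hb]
      rw [Finset.sum_neg_distrib, ← sum_inner, sum_scaledEffect, inner_zero_left, neg_zero])
    hB (by simpa using hm0.mul_const (c₁⁻¹ * ‖t‖))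
    (by
      filter_upwards [hbnorm] with N hN j
      refine (hN j).trans ?_
      gcongr
      exact norm_scaledEffect_le ψ (e N) (θ N) j)
  -- The sandwich matrix has divisor `N - 1`, whereas `∑ j, b N j ^ 2` has divisor `N`.
  have hvar : Tendsto (fun N => ((Real.exp (-((e N).r true * (1 - (e N).r true) / 2) *
      ∑ j, b N j ^ 2) : ℝ) : ℂ) -
      Complex.exp (-(t.ofLp ⬝ᵥ (sandwich Θ ψ (e N) (θ N)).mulVec t.ofLp : ℝ) / 2)) atTop
      (𝓝 0) := by
    have hinv : Tendsto (fun N : ℕ => Q * (c₁⁻¹ * ‖t‖) ^ 2 * ((N : ℝ) - 1)⁻¹) atTop (𝓝 0) := by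
      have : Tendsto (fun N : ℕ => ((N : ℝ) - 1)) atTop atTop :=
        tendsto_atTop_add_const_right _ _ tendsto_natCast_atTop_atTop
      simpa using this.inv_tendsto_atTop.const_mul (Q * (c₁⁻¹ * ‖t‖) ^ 2)
    rw [tendsto_zero_iff_norm_tendsto_zero]
    refine squeeze_zero' (Eventually.of_forall fun _ => norm_nonneg _) ?_ hinv
    filter_upwards [hB, hr0, hr1, eventually_ge_atTop 2] with N hBN h0 h1 hN2
    have hN2' : (2 : ℝ) ≤ N := by exact_mod_cast hN2
    have hq : t.ofLp ⬝ᵥ (sandwich Θ ψ (e N) (θ N)).mulVec t.ofLp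
        = (e N).r true * (1 - (e N).r true) * ((N : ℝ) / (N - 1)) * ∑ j, b N j ^ 2 := by
      rw [dotProduct_sandwich_mulVec_eq_scaledEffect ψ (e N) (θ N) (by omega) Θ t t,
        Population.r_false (by omega)]
      congr 1
      refine Finset.sum_congr rfl fun j _ => ?_
      rw [hb, neg_sq, real_inner_comm, sq]
    have hcast : Complex.exp (-(t.ofLp ⬝ᵥ (sandwich Θ ψ (e N) (θ N)).mulVec t.ofLp : ℝ) / 2)
        = ((Real.exp (-(t.ofLp ⬝ᵥ (sandwich Θ ψ (e N) (θ N)).mulVec t.ofLp / 2)) : ℝ) : ℂ) := by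
      push_cast
      congr 1
      ring
    rw [hcast, ← Complex.ofReal_sub, Complex.norm_real, Real.norm_eq_abs, hq, neg_mul]
    have hv0 : 0 ≤ (e N).r true * (1 - (e N).r true) := mul_nonneg (by linarith) (by linarith)
    have hv1 : (e N).r true * (1 - (e N).r true) ≤ 1 := by nlinarith
    have hs0 : 0 ≤ ∑ j, b N j ^ 2 := Finset.sum_nonneg fun _ _ => sq_nonneg _
    have hfrac : (N : ℝ) / (N - 1) = 1 + ((N : ℝ) - 1)⁻¹ := by
      have : (N : ℝ) - 1 ≠ 0 := by linarith
      field_simp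
      ring
    have hi0 : 0 ≤ ((N : ℝ) - 1)⁻¹ := inv_nonneg.2 (by linarith)
    have hvs := mul_nonneg hv0 hs0
    have hvsi := mul_nonneg hvs hi0
    refine (abs_exp_neg_sub_exp_neg_le ?_ ?_).trans ?_
    · linarith
    · rw [hfrac]; linarith
    · rw [hfrac]
      have h5 : (e N).r true * (1 - (e N).r true) * ∑ j, b N j ^ 2 ≤ Q * (c₁⁻¹ * ‖t‖) ^ 2 :=
        (mul_le_of_le_one_left hs0 hv1).trans hBN
      have h6 := mul_le_mul_of_nonneg_right h5 hi0
      linarith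
  have hsum := hclt.add hvar
  rw [add_zero] at hsum
  refine hsum.congr' ?_
  filter_upwards [eventually_ge_atTop N₀, eventually_gt_atTop 0] with N hN hNpos
  rw [sub_add_sub_cancel]
  congr 1
  have hmeas : AEMeasurable (fun ω => linearApprox Θ ψ (e N) (θ N) (Z N ω)) (P N) :=
    ((Measurable.of_discrete (f := linearApprox Θ ψ (e N) (θ N))).comp (hZ N hN).1).aemeasurable
  rw [charFun_apply, integral_map hmeas (by fun_prop)]
  refine integral_congr_ae ?_
  filter_upwards [(hZ N hN).ae_numTreated_eq] with ω hω
  congr 3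
  rw [linearApprox, sqrt_smul_empPsi hNpos (h1.1 N hN).2 hω, inner_neg_left,
    inner_toEuclideanLin_left, Matrix.transpose_nonsing_inv, sum_inner, ← Finset.sum_neg_distrib]
  refine Finset.sum_congr rfl fun j _ => ?_
  rw [real_inner_smul_left, hb]
  ring

theorem exists_abs_sandwich_le (h3 : Boundedness N₀ Θ ψ e θ) :
    ∃ K, ∀ᶠ N in atTop, ∀ i j, |sandwich Θ ψ (e N) (θ N) i j| ≤ K := by
  obtain ⟨Q, hQ0, hQ⟩ := exists_sum_norm_sq_scaledEffect_le h3
  obtain ⟨⟨c, hc, hr⟩, -, ⟨c₁, c₂, hc₁, -, hσ⟩, -⟩ := h3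
  refine ⟨2 * (c₁⁻¹ ^ 2 * Q), ?_⟩
  filter_upwards [hQ, eventually_ge_atTop N₀, eventually_ge_atTop 2] with N hQN hN hN2 i j
  have hN2' : (2 : ℝ) ≤ N := by exact_mod_cast hN2
  have h := dotProduct_sandwich_mulVec_eq_scaledEffect ψ (e N) (θ N) (by omega) Θ
    (EuclideanSpace.single i (1 : ℝ)) (EuclideanSpace.single j (1 : ℝ))
  have hent : (EuclideanSpace.single i (1 : ℝ)).ofLp ⬝ᵥ (sandwich Θ ψ (e N) (θ N)).mulVec
      (EuclideanSpace.single j (1 : ℝ)).ofLp = sandwich Θ ψ (e N) (θ N) i j := by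
    simp
  rw [hent] at h
  have hK : ∀ a : Fin p, ‖(jacobian Θ (popPsi ψ (e N)) (θ N)).transpose⁻¹.toEuclideanLin
      (EuclideanSpace.single a (1 : ℝ))‖ ≤ c₁⁻¹ := by
    intro a
    have := norm_toEuclideanLin_transpose_inv_le hc₁ (hσ N hN).1 (EuclideanSpace.single a (1 : ℝ))
    simpa using this
  rw [h, abs_mul]
  have hr1 := hr N hN true
  have hv0 : 0 ≤ (e N).r true * (1 - (e N).r true) := mul_nonneg (by linarith) (by linarith)
  have hv1 : (e N).r true * (1 - (e N).r true) ≤ 1 := by nlinarith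
  have hfrac0 : 0 ≤ (N : ℝ) / (N - 1) := div_nonneg (by linarith) (by linarith)
  have hfrac : (N : ℝ) / (N - 1) ≤ 2 := by
    rw [div_le_iff₀ (by linarith)]; linarith
  refine mul_le_mul ?_ ?_ (abs_nonneg _) (by norm_num)
  · rw [Population.r_false (by omega), abs_of_nonneg (mul_nonneg hv0 hfrac0)]
    exact (mul_le_of_le_one_left hfrac0 hv1).trans hfrac
  · refine (Finset.abs_sum_le_sum_abs _ _).trans ?_
    calc _ ≤ ∑ k, c₁⁻¹ ^ 2 * ‖scaledEffect ψ (e N) (θ N) k‖ ^ 2 := by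
          refine Finset.sum_le_sum fun k _ => ?_
          have hs : ∀ a : Fin p, |inner ℝ
              ((jacobian Θ (popPsi ψ (e N)) (θ N)).transpose⁻¹.toEuclideanLin
              (EuclideanSpace.single a (1 : ℝ))) (scaledEffect ψ (e N) (θ N) k)|
              ≤ c₁⁻¹ * ‖scaledEffect ψ (e N) (θ N) k‖ := fun a =>
            (abs_real_inner_le_norm _ _).trans
              (mul_le_mul_of_nonneg_right (hK a) (norm_nonneg _))
          rw [abs_mul, ← mul_pow, sq]
          exact mul_le_mul (hs i) (hs j) (abs_nonneg _) (by positivity)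
      _ ≤ _ := by
          rw [← Finset.mul_sum]
          gcongr

theorem tendsto_levyProkhorovEDist_linearApprox
    (hZ : ∀ N, N₀ ≤ N → IsCRE (P N) (e N).treated (Z N))
    (h1 : InteriorRoot N₀ Θ ψ e θ) (h3 : Boundedness N₀ Θ ψ e θ) :
    Tendsto (fun N => levyProkhorovEDist
      ((P N).map fun ω => linearApprox Θ ψ (e N) (θ N) (Z N ω))
      (multivariateGaussian 0 (sandwich Θ ψ (e N) (θ N)))) atTop (𝓝 0) := by
  obtain ⟨K, hK⟩ := exists_abs_sandwich_le h3
  -- For `N < N₀` nothing is known about `Z N`, not even measurability.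
  set μ : ℕ → Measure (Vec p) := fun N => if N₀ ≤ N then
    (P N).map fun ω => linearApprox Θ ψ (e N) (θ N) (Z N ω) else Measure.dirac 0 with hμ
  have hμN : ∀ᶠ N in atTop,
      μ N = (P N).map fun ω => linearApprox Θ ψ (e N) (θ N) (Z N ω) := by
    filter_upwards [eventually_ge_atTop N₀] with N hN
    exact if_pos hN
  have hprob : ∀ N, IsProbabilityMeasure (μ N) := by
    intro N
    simp only [hμ]
    split_ifs with hN
    · exact Measure.isProbabilityMeasure_map
        ((Measurable.of_discrete (f := linearApprox Θ ψ (e N) (θ N))).comp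
          (hZ N hN).1).aemeasurable
    · infer_instance
  have h := tendsto_levyProkhorovEDist_multivariateGaussian (μ := μ)
    (S := fun N => sandwich Θ ψ (e N) (θ N)) (K := K) ?_ hK ?_
  · refine h.congr' ?_
    filter_upwards [hμN] with N hN
    rw [hN]
  · obtain ⟨⟨c, hc, hr⟩, -⟩ := h3
    filter_upwards [eventually_ge_atTop N₀, eventually_ge_atTop 1] with N hN hN1
    exact posSemidef_sandwich Θ ψ (e N) (θ N) hN1 (hc.le.trans (hr N hN true).1)
      (hc.le.trans (hr N hN false).1)
  · intro t
    refine (tendsto_charFun_linearApprox_sub hZ h1 h3 t).congr' ?_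
    filter_upwards [hμN] with N hN
    rw [hN]

/-- The deterministic core of the delta method: a root of the empirical estimating function close to
the population root is well approximated by the linear approximation, provided that the latter is
bounded. -/
theorem norm_sub_linearApprox_le {N : ℕ} {e : Population 𝒳 𝒴 N} {θ₀ ϑ : Vec p} {z : Fin N → Bool}
    {c₁ η M : ℝ} (hc₁ : 0 < c₁) (hσ : c₁ ≤ sigmaMin (jacobian Θ (popPsi ψ e) θ₀)) (hη0 : 0 ≤ η)
    (hη : 4 * η ≤ c₁) (hroot : empPsi ψ e z ϑ = 0)
    (hlin : ‖empPsi ψ e z ϑ - empPsi ψ e z θ₀ -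
      (jacobian Θ (popPsi ψ e) θ₀).toEuclideanLin (ϑ - θ₀)‖ ≤ 2 * η * ‖ϑ - θ₀‖)
    (hM : ‖√(N : ℝ) • empPsi ψ e z θ₀‖ ≤ M) :
    ‖√(N : ℝ) • (ϑ - θ₀) - linearApprox Θ ψ e θ₀ z‖ ≤ 4 * η * M / c₁ ^ 2 := by
  set J := jacobian Θ (popPsi ψ e) θ₀ with hJ
  set D := √(N : ℝ) • (ϑ - θ₀) with hD
  set S := √(N : ℝ) • empPsi ψ e z θ₀ with hS
  have h1 : ‖J.toEuclideanLin D + S‖ ≤ 2 * η * ‖D‖ := by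
    have e1 : J.toEuclideanLin D + S = -(√(N : ℝ) • (empPsi ψ e z ϑ - empPsi ψ e z θ₀ -
        J.toEuclideanLin (ϑ - θ₀))) := by
      rw [hD, hS, hroot, map_smul]
      module
    rw [e1, norm_neg, hD, norm_smul, norm_smul]
    have := mul_le_mul_of_nonneg_left hlin (norm_nonneg √(N : ℝ))
    linarith
  have h2 : c₁ * ‖D‖ ≤ ‖J.toEuclideanLin D‖ :=
    (mul_le_mul_of_nonneg_right hσ (norm_nonneg _)).trans (sigmaMin_mul_norm_le J D)
  have h3 : ‖J.toEuclideanLin D‖ ≤ ‖J.toEuclideanLin D + S‖ + ‖S‖ := by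
    simpa using norm_sub_le (J.toEuclideanLin D + S) S
  have h4 : c₁ * ‖D‖ ≤ 2 * M := by nlinarith [norm_nonneg D]
  have h5 : D - linearApprox Θ ψ e θ₀ z = J⁻¹.toEuclideanLin (J.toEuclideanLin D + S) := by
    rw [map_add, toEuclideanLin_inv_apply (isUnit_det_of_le_sigmaMin hc₁ hσ), linearApprox,
      sub_neg_eq_add]
  rw [h5]
  refine (norm_toEuclideanLin_inv_le hc₁ hσ _).trans ?_
  rw [inv_mul_eq_div, div_le_div_iff₀ hc₁ (by positivity)]
  nlinarith [mul_le_mul_of_nonneg_left h1 (sq_nonneg c₁), mul_le_mul_of_nonneg_left h4 hη0,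
    mul_le_mul_of_nonneg_left h4 (mul_nonneg hη0 hc₁.le)]

/-- The rescaled estimation error is close in probability to its linear approximation. -/
theorem eventually_measure_dist_linearApprox_le
    (hZ : ∀ N, N₀ ≤ N → IsCRE (P N) (e N).treated (Z N)) {θhat : ∀ N, Ω N → Vec p}
    (h1 : InteriorRoot N₀ Θ ψ e θ) (h2 : Smoothness N₀ Θ ψ e θ) (h3 : Boundedness N₀ Θ ψ e θ)
    (h4 : Consistency P Z N₀ Θ ψ e θ θhat) {κ : ℝ} (hκ : 0 < κ) :
    ∀ᶠ N in atTop, P N {ω | κ ≤ dist (√(N : ℝ) • (θhat N ω - θ N))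
      (linearApprox Θ ψ (e N) (θ N) (Z N ω))} ≤ ENNReal.ofReal κ := by
  obtain ⟨Q, hQ0, hQ⟩ := exists_sum_norm_sq_scaledEffect_le h3
  obtain ⟨⟨c, hc, hr⟩, -, ⟨c₁, c₂, hc₁, -, hσ⟩, -⟩ := h3
  obtain ⟨hroot, ε, hε, hball⟩ := h1
  obtain ⟨hest, hcons, ρ, hρ, hunif⟩ := h4
  -- `M` bounds `√N Ψ̂_N(θ_N)` with high probability by Chebyshev's inequality.
  obtain ⟨M, hM0, hM⟩ : ∃ M : ℝ, 0 < M ∧ 2 * Q / M ^ 2 ≤ κ / 3 := by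
    refine ⟨√(6 * Q / κ) + 1, by positivity, ?_⟩
    rw [div_le_iff₀ (by positivity)]
    have hs : √(6 * Q / κ) ^ 2 = 6 * Q / κ := Real.sq_sqrt (by positivity)
    have hs0 := Real.sqrt_nonneg (6 * Q / κ)
    have : 6 * Q / κ ≤ (√(6 * Q / κ) + 1) ^ 2 := by nlinarith
    have h6 := mul_le_mul_of_nonneg_left this (show 0 ≤ κ / 3 by positivity)
    have h7 : κ / 3 * (6 * Q / κ) = 2 * Q := by field_simp; ring
    linarith
  set η : ℝ := min (c₁ / 4) (κ * c₁ ^ 2 / (8 * M)) with hη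
  have hη0 : 0 < η := lt_min (by positivity) (by positivity)
  have hη1 : 4 * η ≤ c₁ := by linarith [min_le_left (c₁ / 4) (κ * c₁ ^ 2 / (8 * M))]
  have hη2 : 4 * η * M / c₁ ^ 2 < κ := by
    rw [div_lt_iff₀ (by positivity)]
    have : η * (8 * M) ≤ κ * c₁ ^ 2 := (le_div_iff₀ (by positivity)).1 (min_le_right _ _)
    nlinarith [mul_pos hη0 hM0]
  have hηe : (0 : ℝ≥0∞) < ENNReal.ofReal η := ENNReal.ofReal_pos.2 hη0
  obtain ⟨δ, ⟨hδosc, hδ0⟩, hδ⟩ : ∃ δ : ℝ, ((∀ z, ∀ N, N₀ ≤ N →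
      (∑ i, osc Θ (fderivWithin ℝ (unitPsi ψ (e N) z i) Θ) (θ N) δ) / (N : ℝ≥0∞)
        ≤ ENNReal.ofReal η) ∧ 0 < δ) ∧ δ < min ε ρ := by
    have hz : ∀ z, ∀ᶠ δ : ℝ in 𝓝[>] 0, ∀ N, N₀ ≤ N →
        (∑ i, osc Θ (fderivWithin ℝ (unitPsi ψ (e N) z i) Θ) (θ N) δ) / (N : ℝ≥0∞)
          ≤ ENNReal.ofReal η := by
      intro z
      filter_upwards [(h2 z).2.1.eventually_le_const hηe] with δ hδ N hN
      exact (le_iSup₂ (f := fun N (_ : N ≥ N₀) =>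
        (∑ i, osc Θ (fderivWithin ℝ (unitPsi ψ (e N) z i) Θ) (θ N) δ) / (N : ℝ≥0∞)) N hN).trans hδ
    have hlt : ∀ᶠ δ : ℝ in 𝓝[>] 0, δ < min ε ρ :=
      (eventually_lt_nhds (lt_min hε hρ)).filter_mono nhdsWithin_le_nhds
    exact (((eventually_all.2 hz).and self_mem_nhdsWithin).and hlt).exists
  have hκ3 : (0 : ℝ≥0∞) < ENNReal.ofReal (κ / 3) := ENNReal.ofReal_pos.2 (by positivity)
  have hbad1 := (hcons (ENNReal.ofReal δ) (ENNReal.ofReal_pos.2 hδ0)).eventually_le_const hκ3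
  have hbad2 := (hunif (ENNReal.ofReal η) hηe).eventually_le_const hκ3
  filter_upwards [hbad1, hbad2, hQ, eventually_ge_atTop N₀, eventually_gt_atTop 0] with N hb1 hb2
    hQN hN hNpos
  have hr1 := hr N hN true
  have hr0 := hr N hN false
  have hb3 : P N {ω | M ≤ ‖∑ i, centered ((e N).r true) (Z N ω i) •
      scaledEffect ψ (e N) (θ N) i‖} ≤ ENNReal.ofReal (κ / 3) := by
    rw [← ofReal_measureReal]
    refine ENNReal.ofReal_le_ofReal ?_
    refine (measureReal_norm_sum_centered_ge_le (hZ N hN) (by linarith) (by linarith)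
      (sum_scaledEffect ψ (e N) (θ N)) hM0).trans (le_trans ?_ hM)
    gcongr
  have hsub : ∀ᵐ ω ∂(P N), ω ∈ {ω | κ ≤ dist (√(N : ℝ) • (θhat N ω - θ N))
      (linearApprox Θ ψ (e N) (θ N) (Z N ω))} →
      ω ∈ {ω | ENNReal.ofReal δ ≤ ‖θhat N ω - θ N‖ₑ} ∪
        {ω | ENNReal.ofReal η ≤ ⨆ ϑ ∈ {ϑ | ϑ ∈ Θ ∧ ‖ϑ - θ N‖ ≤ ρ},
          ‖fderivWithin ℝ (empPsi ψ (e N) (Z N ω)) Θ ϑ -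
            fderivWithin ℝ (popPsi ψ (e N)) Θ ϑ‖ₑ} ∪
        {ω | M ≤ ‖∑ i, centered ((e N).r true) (Z N ω i) • scaledEffect ψ (e N) (θ N) i‖} := by
    filter_upwards [(hZ N hN).ae_numTreated_eq, hest N hN] with ω hω hωest hωκ
    by_contra hgood
    simp only [Set.mem_union, Set.mem_ofPred_eq, not_or, not_le] at hgood
    obtain ⟨⟨hg1, hg2⟩, hg3⟩ := hgood
    have hclose : ‖θhat N ω - θ N‖ ≤ δ := by
      rw [← ofReal_norm, ENNReal.ofReal_lt_ofReal_iff hδ0] at hg1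
      exact hg1.le
    have hlin := norm_empPsi_sub_sub_le (fun z => (h2 z).1) hNpos (by linarith) (by linarith)
      (hball N hN) hδ0.le (hδ.trans_le (min_le_left _ _)) (hδ.trans_le (min_le_right _ _)).le
      hη0.le (fun z => hδosc z N hN) hg2.le hclose
    have := norm_sub_linearApprox_le hc₁ (hσ N hN).1 hη0.le hη1 hωest.2 hlin (M := M)
      (by rw [sqrt_smul_empPsi hNpos (hroot N hN).2 hω]; exact hg3.le)
    rw [dist_eq_norm] at hωκ
    linarith
  refine (measure_mono_ae hsub).trans ((measure_union_le _ _).trans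
    ((add_le_add (measure_union_le _ _) le_rfl).trans
      ((add_le_add (add_le_add hb1 hb2) hb3).trans_eq ?_)))
  rw [← ENNReal.ofReal_add (by positivity) (by positivity),
    ← ENNReal.ofReal_add (by positivity) (by positivity)]
  congr 1
  ring

end Normality

end RandomizedZ

theorem theorem1 {𝒳 𝒴 : Type*} {p : ℕ} (N₀ : ℕ)
    -- parameter space, estimating functions, finite populations, population roots
    (Θ : Set (RandomizedZ.Vec p))
    (ψ : Bool → 𝒴 → 𝒳 → RandomizedZ.Vec p → RandomizedZ.Vec p)
    (e : ∀ N, RandomizedZ.Population 𝒳 𝒴 N)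
    (θ : ℕ → RandomizedZ.Vec p)
    -- the completely randomized experiments and the estimators
    {Ω : ℕ → Type*} [∀ N, MeasurableSpace (Ω N)]
    (P : ∀ N, Measure (Ω N)) [∀ N, IsProbabilityMeasure (P N)]
    (Z : ∀ N, Ω N → Fin N → Bool)
    (hZ : ∀ N, N₀ ≤ N → RandomizedZ.IsCRE (P N) (e N).treated (Z N))
    (θhat : ∀ N, Ω N → RandomizedZ.Vec p)
    (hθhat : ∀ N, N₀ ≤ N → AEMeasurable (θhat N) (P N))
    (h1 : RandomizedZ.InteriorRoot N₀ Θ ψ e θ)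
    (h2 : RandomizedZ.Smoothness N₀ Θ ψ e θ)
    (h3 : RandomizedZ.Boundedness N₀ Θ ψ e θ)
    (h4 : RandomizedZ.Consistency P Z N₀ Θ ψ e θ θhat) :
    Tendsto (fun N : ℕ => levyProkhorovEDist
        ((P N).map fun ω => √(N : ℝ) • (θhat N ω - θ N))
        (multivariateGaussian 0 (RandomizedZ.sandwich Θ ψ (e N) (θ N))))
      atTop (𝓝 0) := by
  have hdelta : Tendsto (fun N : ℕ => levyProkhorovEDist
      ((P N).map fun ω => √(N : ℝ) • (θhat N ω - θ N))
      ((P N).map fun ω => RandomizedZ.linearApprox Θ ψ (e N) (θ N) (Z N ω))) atTop (𝓝 0) := by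
    rw [ENNReal.tendsto_nhds_zero]
    intro ε hε
    obtain ⟨κ, hκ0, hκ⟩ : ∃ κ : ℝ, 0 < κ ∧ ENNReal.ofReal κ ≤ ε := by
      obtain ⟨q, hq0, hq⟩ := ENNReal.lt_iff_exists_nnreal_btwn.1 hε
      exact ⟨q, by exact_mod_cast hq0, by simpa using hq.le⟩
    filter_upwards [RandomizedZ.eventually_measure_dist_linearApprox_le hZ h1 h2 h3 h4 hκ0,
      eventually_ge_atTop N₀] with N h hN
    refine (RandomizedZ.levyProkhorovEDist_map_le ?_ ?_ h).trans hκ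
    · exact ((hθhat N hN).sub_const _).const_smul √(N : ℝ)
    · exact ((Measurable.of_discrete (f := RandomizedZ.linearApprox Θ ψ (e N) (θ N))).comp
        (hZ N hN).1).aemeasurable
  have h := hdelta.add (RandomizedZ.tendsto_levyProkhorovEDist_linearApprox hZ h1 h3)
  rw [add_zero] at h
  exact tendsto_of_tendsto_of_tendsto_of_le_of_le tendsto_const_nhds h (fun _ => zero_le)
    fun N => levyProkhorovEDist_triangle _ _ _
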